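/- For a binary $p\times q$ matrix $P=(p_{ij})$, a binary $m\times n$ matrix $B=(b_{st})$ is a $P$-matrix if there are a partition $\{I_1,\dots,I_p\}$ of $\{1,\dots,m\}$ and a partition $\{J_1,\dots,J_q\}$ of $\{1,\dots,n\}$, all parts nonempty, such that $b_{st}=p_{ij}$ for all $i\in\{1,\dots,p\}$, $j\in\{1,\dots,q\}$, $s\in I_i$, $t\in J_j$. The problem $P$-Matrix Approximation is: given a binary $m\times n$ matrix $A$, a binary $p\times q$ matrix $P$ (where $m,n,p,q\ge 1$) and an integer $k\ge 0$, decide whether there is a binary $m\times n$ $P$-matrix $B$ with $\|A-B\|_F^2\le k$ (equivalently, differing from $A$ in at most $k$ entries). Theorem. $P$-Matrix Approximation is solvable in time $$2^{\mathcal{O}\left((p+q)\sqrt{k\log(p+k)}+p\log p+q\log q+q\log(q+k)\right)}\cdot (nm)^{\mathcal{O}(1)}.$$ That is, there are a single deterministic random access machine program and an absolute constant $C$ such that on every instance $(A,P,k)$ the program halts with the correct answer after at most $C\cdot 2^{C\left((p+q)\sqrt{k\log_2(p+k)}+p\log_2 p+q\log_2 q+q\log_2(q+k)\right)}\cdot (nm)^{C}$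 steps. (The machine works on natural numbers, with addition, truncated subtraction, zero tests and indirect addressing, each at unit cost.) -/

import Mathlib

/-! ### A random access machine

Programs are structured (assignment, sequence, conditional, loop). The store consists of
variables and of arrays, all holding natural numbers of unbounded size; a program, being finite,
names finitely many variables and arrays, but the cells of an array are addressed by computed
values. The only arithmetic is addition and truncated subtraction. Each constant, read of a
variable or of an array cell, addition, subtraction, write and test takes one step. In
the absence of multiplication this uniform cost is polynomially related to the running time of
Turing machines. -/

namespace RAM

/-- The contents of the memory. -/
structure Store where
  /-- the value of each variable -/
  var : ℕ → ℕ
  /-- `arr a i` is the `i`-th cell of the array `a` -/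
  arr : ℕ → ℕ → ℕ

/-- Arithmetic expressions. -/
inductive Exp where
  /-- a constant -/
  | const (c : ℕ)
  /-- the value of a variable -/
  | var (x : ℕ)
  /-- the cell of the array `a` at a computed address -/
  | cell (a : ℕ) (e : Exp)
  /-- sum -/
  | add (e f : Exp)
  /-- truncated difference -/
  | sub (e f : Exp)

/-- The value of an expression. -/
def Exp.eval (s : Store) : Exp → ℕ
  | .const c => c
  | .var x => s.var x
  | .cell a e => s.arr a (e.eval s)
  | .add e f => e.eval s + f.eval s
  | .sub e f => e.eval s - f.eval s

/-- The number of steps that the evaluation of an expression takes. -/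
def Exp.cost : Exp → ℕ
  | .const _ => 1
  | .var _ => 1
  | .cell _ e => e.cost + 1
  | .add e f => e.cost + f.cost + 1
  | .sub e f => e.cost + f.cost + 1

/-- Programs. -/
inductive Prog where
  /-- do nothing -/
  | skip
  /-- `x := e` -/
  | assign (x : ℕ) (e : Exp)
  /-- `a[e] := f` -/
  | store (a : ℕ) (e f : Exp)
  /-- `c; d` -/
  | seq (c d : Prog)
  /-- `if e ≠ 0 then c else d` -/
  | ite (e : Exp) (c d : Prog)
  /-- `while e ≠ 0 do c` -/
  | loop (e : Exp) (c : Prog)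

/-- `Run c s s' t`: the program `c`, started with the store `s`, halts after exactly `t` steps
with the store `s'`. -/
inductive Run : Prog → Store → Store → ℕ → Prop where
  | skip (s : Store) : Run .skip s s 1
  | assign (s : Store) (x : ℕ) (e : Exp) :
      Run (.assign x e) s { s with var := Function.update s.var x (e.eval s) } (e.cost + 1)
  | store (s : Store) (a : ℕ) (e f : Exp) :
      Run (.store a e f) s
        { s with arr := Function.update s.arr a
                          (Function.update (s.arr a) (e.eval s) (f.eval s)) }
        (e.cost + f.cost + 1)
  | seq {c d : Prog} {s s' s'' : Store} {t t' : ℕ} :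
      Run c s s' t → Run d s' s'' t' → Run (.seq c d) s s'' (t + t')
  | ite_true {e : Exp} {c d : Prog} {s s' : Store} {t : ℕ} :
      e.eval s ≠ 0 → Run c s s' t → Run (.ite e c d) s s' (e.cost + 1 + t)
  | ite_false {e : Exp} {c d : Prog} {s s' : Store} {t : ℕ} :
      e.eval s = 0 → Run d s s' t → Run (.ite e c d) s s' (e.cost + 1 + t)
  | loop_false {e : Exp} {c : Prog} {s : Store} :
      e.eval s = 0 → Run (.loop e c) s s (e.cost + 1)
  | loop_true {e : Exp} {c : Prog} {s s' s'' : Store} {t t' : ℕ} :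
      e.eval s ≠ 0 → Run c s s' t → Run (.loop e c) s' s'' t' →
      Run (.loop e c) s s'' (e.cost + 1 + t + t')

/-- The machine is deterministic: the final store and the number of steps are determined by the
program and the initial store. -/
theorem Run.deterministic {c : Prog} {s s₁ s₂ : Store} {t₁ t₂ : ℕ}
    (h₁ : Run c s s₁ t₁) (h₂ : Run c s s₂ t₂) : s₁ = s₂ ∧ t₁ = t₂ := by
  induction h₁ generalizing s₂ t₂ with
  | skip => cases h₂; exact ⟨rfl, rfl⟩
  | assign => cases h₂; exact ⟨rfl, rfl⟩
  | store => cases h₂; exact ⟨rfl, rfl⟩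
  | seq _ _ ih ih' =>
    cases h₂ with
    | seq a b =>
      obtain ⟨rfl, rfl⟩ := ih a
      obtain ⟨rfl, rfl⟩ := ih' b
      exact ⟨rfl, rfl⟩
  | ite_true he _ ih =>
    cases h₂ with
    | ite_true _ a => obtain ⟨rfl, rfl⟩ := ih a; exact ⟨rfl, rfl⟩
    | ite_false he' _ => exact absurd he' he
  | ite_false he _ ih =>
    cases h₂ with
    | ite_true he' _ => exact absurd he he'
    | ite_false _ a => obtain ⟨rfl, rfl⟩ := ih a; exact ⟨rfl, rfl⟩
  | loop_false he =>
    cases h₂ with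
    | loop_false _ => exact ⟨rfl, rfl⟩
    | loop_true he' _ _ => exact absurd he he'
  | loop_true he _ _ ih ih' =>
    cases h₂ with
    | loop_false he' => exact absurd he' he
    | loop_true _ a b =>
      obtain ⟨rfl, rfl⟩ := ih a
      obtain ⟨rfl, rfl⟩ := ih' b
      exact ⟨rfl, rfl⟩

end RAM

/-! ### The problem -/

namespace PMatrixApproximation

/-- `{I 1, …, I p}` is a partition of `{1, …, m}` into `p` nonempty sets. -/
def IsPartition {m p : ℕ} (I : Fin p → Finset (Fin m)) : Prop :=
  (∀ i, (I i).Nonempty) ∧ (∀ i i', i ≠ i' → Disjoint (I i) (I i')) ∧ ∀ s, ∃ i, s ∈ I i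

/-- The binary `m × n` matrix `B` is a `P`-matrix: there are partitions of the rows and of the
columns such that `B` is constantly `P i j` on the block `I i × J j`. -/
def IsPMatrix {m n p q : ℕ} (P : Matrix (Fin p) (Fin q) Bool) (B : Matrix (Fin m) (Fin n) Bool) :
    Prop :=
  ∃ (I : Fin p → Finset (Fin m)) (J : Fin q → Finset (Fin n)), IsPartition I ∧ IsPartition J ∧
    ∀ i j, ∀ s ∈ I i, ∀ t ∈ J j, B s t = P i j

/-- The squared Frobenius norm of `A - B`, for `A`, `B` seen as real `0`-`1` matrices. -/
noncomputable def frobeniusSq {m n : ℕ} (A B : Matrix (Fin m) (Fin n) Bool) : ℝ :=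
  ∑ s, ∑ t, (((A s t).toNat : ℝ) - ((B s t).toNat : ℝ)) ^ 2

/-- `(A, P, k)` is a yes-instance: some `P`-matrix `B` has `‖A - B‖² ≤ k`. -/
def IsYes {m n p q : ℕ} (A : Matrix (Fin m) (Fin n) Bool) (P : Matrix (Fin p) (Fin q) Bool)
    (k : ℕ) : Prop :=
  ∃ B : Matrix (Fin m) (Fin n) Bool, IsPMatrix P B ∧ frobeniusSq A B ≤ k

/-- The list of the entries of a binary matrix, row by row, followed by zeros. -/
def rowMajor {m n : ℕ} (A : Matrix (Fin m) (Fin n) Bool) (t : ℕ) : ℕ :=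
  if h : t / n < m ∧ t % n < n then (A ⟨t / n, h.1⟩ ⟨t % n, h.2⟩).toNat else 0

/-- The initial store for the instance `(A, P, k)`: the variables `0, …, 4` hold `m`, `n`, `p`,
`q`, `k`, the arrays `0` and `1` hold the entries of `A` and of `P`, and all else is zero. -/
def input {m n p q : ℕ} (A : Matrix (Fin m) (Fin n) Bool) (P : Matrix (Fin p) (Fin q) Bool)
    (k : ℕ) : RAM.Store where
  var x := if x = 0 then m else if x = 1 then n else if x = 2 then p else if x = 3 then q
    else if x = 4 then k else 0
  arr a := if a = 0 then rowMajor A else if a = 1 then rowMajor P else fun _ => 0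

/-- `(p + q) √(k log (p + k)) + p log p + q log q + q log (q + k)`. -/
noncomputable def exponent (p q k : ℕ) : ℝ :=
  ((p : ℝ) + q) * √((k : ℝ) * Real.logb 2 ((p : ℝ) + k)) + p * Real.logb 2 p + q * Real.logb 2 q
    + q * Real.logb 2 ((q : ℝ) + k)

end PMatrixApproximation

/-!
The problem asks for a map `σ` of the rows of `A` onto the rows of `P` and a map `τ` of the columns
onto the columns such that at most `k` entries `A s t` differ from `P (σ s) (τ t)`. The algorithm
tries all values of a guess that determines `σ` and `τ`, and accepts if some pair so obtained is a
solution; it can err only by missing a solution.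

The guess. Put `δ ≈ √(k / log (p + k))`. Given a solution, call a column class good if one of its
columns has at most `δ` errors. For every column class a representative with the fewest errors is
guessed, for the good classes also the at most `δ` rows in which the representative is wrong; this
yields the correct pattern of each good class. A column is far if its distance from all these
patterns exceeds `δ`. Far columns have more than `δ` errors, so there are at most
`k / (δ + 1) ≤ √(k log (p + k))` of them, and their classes are guessed. Each of the remaining
columns goes to a nearest good class, which does not increase the number of its errors: at most `δ`
of them remain, and if the old class was bad, there were more than `δ`. The representatives keep all
classes nonempty. Once `τ` is known, a guessed representative for each row class keeps the row
classes nonempty, and every other row takes the class with the fewest errors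
(`Inst.search_of_isSol`).

The number of guesses. Representatives and wrong rows are not taken from all of `A`. As at most `k`
rows have errors, there are at most `p + k` distinct rows, and equal rows may be exchanged so that
all rows with errors and all representatives are among the first `p + k` of their kind
(`exists_perm_rank_lt`). This leaves `(p + k) ^ 2` candidates, and `(q + k) ^ 2` for the columns.
The guesses thus number at most
`(q + k) ^ (2 q) * ((p + k) ^ 2 + 1) ^ (q δ) * 2 ^ q * q ^ (k / (δ + 1)) * (p + k) ^ (2 p)`, and each
factor is polynomial in `2 ^ exponent p q k` (`Inst.colReps_bound` and the lemmas after it). For the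
last one, `log (p + k) ≤ log p + √(k log (p + k))`.

The program. Since all these numbers, and `p`, `q`, `k`, are polynomial in
`N = 2 ^ exponent p q k * n m`, it suffices to compute the search in time polynomial in `N`, where
a guess may be a number that is decoded digit by digit. Functions computable in this way are obtained
from a small functional language with bounded iteration that compiles to the machine
(`RAM.Tm.run_compile`). `PT f` says that `f` is computed by a term of this language with value and
time polynomial in `N` and the local values; the closure properties of `PT` and of its companion
`PD` for predicates then mirror the definition of the search (`PD.search`).
-/

/-! ### A functional language for the machine -/

namespace RAM

/-- The value of `x` after `x := z; for i < b do x := f i x`. -/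
def loopVal (f : ℕ → ℕ → ℕ) (z : ℕ) : ℕ → ℕ
  | 0 => z
  | i + 1 => f i (loopVal f z i)

/-- A functional language that compiles to RAM programs. A term reads the variables `0, …, 4` and
the arrays of a store, which it does not change, and a list of local values that are addressed by
de Bruijn indices. The only binder is `iter`. -/
inductive Tm where
  /-- a constant -/
  | const (c : ℕ)
  /-- a variable of the store -/
  | var (x : Fin 5)
  /-- a local value -/
  | loc (i : ℕ)
  /-- a cell of the array `a` -/
  | cell (a : ℕ) (t : Tm)
  /-- sum -/
  | add (t u : Tm)
  /-- truncated difference -/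
  | sub (t u : Tm)
  /-- `t` if `c ≠ 0`, and `u` otherwise -/
  | ite (c t u : Tm)
  /-- `b`-fold iteration of `f` from `z`; in `f`, the local value `0` is the accumulator and the
  local value `1` is the number of the iteration -/
  | iter (b z f : Tm)

namespace Tm

/-- The value of a term. -/
def eval (s : Store) : Tm → List ℕ → ℕ
  | const c, _ => c
  | var x, _ => s.var x
  | loc i, l => l.getD i 0
  | cell a t, l => s.arr a (t.eval s l)
  | add t u, l => t.eval s l + u.eval s l
  | sub t u, l => t.eval s l - u.eval s l
  | ite c t u, l => if c.eval s l ≠ 0 then t.eval s l else u.eval s l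
  | iter b z f, l => loopVal (fun i acc => f.eval s (acc :: i :: l)) (z.eval s l) (b.eval s l)

/-- A bound for the number of steps of the compiled term. Both branches of a conditional are
counted. -/
def time (s : Store) : Tm → List ℕ → ℕ
  | const _, _ => 2
  | var _, _ => 2
  | loc _, _ => 2
  | cell _ t, l => t.time s l + 3
  | add t u, l => t.time s l + u.time s l + 4
  | sub t u, l => t.time s l + u.time s l + 4
  | ite c t u, l => c.time s l + t.time s l + u.time s l + 2
  | iter b z f, l => z.time s l + b.time s l + 6 +
      ∑ i ∈ Finset.range (b.eval s l),
        (f.time s (loopVal (fun i acc => f.eval s (acc :: i :: l)) (z.eval s l) i :: i :: l) + 10)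

/-- The program that computes a term. The local values are in the variables listed in `ρ`, the
result goes to the variable `d`, and the variables below `d` are left alone. -/
def compile : Tm → List ℕ → ℕ → Prog
  | const c, _, d => .assign d (.const c)
  | var x, _, d => .assign d (.var x)
  | loc i, ρ, d => .assign d ((ρ[i]?).elim (.const 0) .var)
  | cell a t, ρ, d => .seq (t.compile ρ d) (.assign d (.cell a (.var d)))
  | add t u, ρ, d => .seq (t.compile ρ d) (.seq (u.compile ρ (d + 1))
      (.assign d (.add (.var d) (.var (d + 1)))))
  | sub t u, ρ, d => .seq (t.compile ρ d) (.seq (u.compile ρ (d + 1))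
      (.assign d (.sub (.var d) (.var (d + 1)))))
  | ite c t u, ρ, d => .seq (c.compile ρ d) (.ite (.var d) (t.compile ρ d) (u.compile ρ d))
  | iter b z f, ρ, d => .seq (z.compile ρ d) (.seq (b.compile ρ (d + 1))
      (.seq (.assign (d + 2) (.const 0))
        (.loop (.sub (.var (d + 1)) (.var (d + 2)))
          (.seq (f.compile (d :: (d + 2) :: ρ) (d + 3))
            (.seq (.assign d (.var (d + 3)))
              (.assign (d + 2) (.add (.var (d + 2)) (.const 1))))))))

/-- `s'` agrees with `s` on the arrays and on the variables below `d`. -/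
def AgreeBelow (d : ℕ) (s s' : Store) : Prop :=
  s'.arr = s.arr ∧ ∀ x < d, s'.var x = s.var x

theorem AgreeBelow.trans {d : ℕ} {s s' s'' : Store} (h : AgreeBelow d s s')
    (h' : AgreeBelow d s' s'') : AgreeBelow d s s'' :=
  ⟨h'.1.trans h.1, fun x hx => (h'.2 x hx).trans (h.2 x hx)⟩

theorem AgreeBelow.mono {d e : ℕ} {s s' : Store} (h : AgreeBelow e s s') (hde : d ≤ e) :
    AgreeBelow d s s' :=
  ⟨h.1, fun x hx => h.2 x (hx.trans_le hde)⟩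

theorem agreeBelow_update (s : Store) {d x : ℕ} (v : ℕ) (h : d ≤ x) :
    AgreeBelow d s { s with var := Function.update s.var x v } :=
  ⟨rfl, fun y hy => Function.update_of_ne (by omega) _ _⟩

theorem AgreeBelow.map_var {d : ℕ} {s s' : Store} (h : AgreeBelow d s s') {ρ : List ℕ}
    (hρ : ∀ x ∈ ρ, x < d) : ρ.map s'.var = ρ.map s.var :=
  List.map_congr_left fun x hx => h.2 x (hρ x hx)

/-- Compiled terms are correct and respect the time bound. The variables of the store `s₀` below `5`
and its arrays are the input; a program run later finds them unchanged. -/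
theorem run_compile (s₀ : Store) (t : Tm) :
    ∀ (ρ : List ℕ) (d : ℕ) (s : Store), 5 ≤ d → (∀ x ∈ ρ, x < d) → AgreeBelow 5 s₀ s →
      ∃ s' T, Run (t.compile ρ d) s s' T ∧ AgreeBelow d s s' ∧
        s'.var d = t.eval s₀ (ρ.map s.var) ∧ T ≤ t.time s₀ (ρ.map s.var) := by
  induction t with
  | const c =>
    intro ρ d s _ _ _
    exact ⟨_, _, .assign _ _ _, agreeBelow_update s _ le_rfl, by simp [eval, Exp.eval],
      by simp [time, Exp.cost]⟩
  | var x =>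
    intro ρ d s _ _ h
    exact ⟨_, _, .assign _ _ _, agreeBelow_update s _ le_rfl,
      by simp [eval, Exp.eval, h.2 x x.2], by simp [time, Exp.cost]⟩
  | loc i =>
    intro ρ d s _ _ h
    refine ⟨_, _, .assign _ _ _, agreeBelow_update s _ le_rfl, ?_, ?_⟩ <;>
      cases hi : ρ[i]? <;> simp [eval, time, Exp.eval, Exp.cost, hi]
  | cell a t ih =>
    intro ρ d s hd hρ h
    obtain ⟨s₁, T₁, r₁, a₁, v₁, b₁⟩ := ih ρ d s hd hρ h
    refine ⟨_, _, .seq r₁ (.assign _ _ _), a₁.trans (agreeBelow_update _ _ le_rfl), ?_, ?_⟩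
    · simp [eval, Exp.eval, v₁, a₁.1, h.1]
    · simp only [time, Exp.cost]; omega
  | add t u iht ihu =>
    intro ρ d s hd hρ h
    obtain ⟨s₁, T₁, r₁, a₁, v₁, b₁⟩ := iht ρ d s hd hρ h
    obtain ⟨s₂, T₂, r₂, a₂, v₂, b₂⟩ := ihu ρ (d + 1) s₁ (by omega)
      (fun x hx => (hρ x hx).trans (by omega)) (h.trans (a₁.mono hd))
    rw [a₁.map_var hρ] at v₂ b₂
    refine ⟨_, _, .seq r₁ (.seq r₂ (.assign _ _ _)),
      (a₁.trans (a₂.mono (by omega))).trans (agreeBelow_update _ _ le_rfl), ?_, ?_⟩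
    · simp [eval, Exp.eval, v₂, a₂.2 d (by omega), v₁]
    · simp only [time, Exp.cost]; omega
  | sub t u iht ihu =>
    intro ρ d s hd hρ h
    obtain ⟨s₁, T₁, r₁, a₁, v₁, b₁⟩ := iht ρ d s hd hρ h
    obtain ⟨s₂, T₂, r₂, a₂, v₂, b₂⟩ := ihu ρ (d + 1) s₁ (by omega)
      (fun x hx => (hρ x hx).trans (by omega)) (h.trans (a₁.mono hd))
    rw [a₁.map_var hρ] at v₂ b₂
    refine ⟨_, _, .seq r₁ (.seq r₂ (.assign _ _ _)),
      (a₁.trans (a₂.mono (by omega))).trans (agreeBelow_update _ _ le_rfl), ?_, ?_⟩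
    · simp [eval, Exp.eval, v₂, a₂.2 d (by omega), v₁]
    · simp only [time, Exp.cost]; omega
  | ite c t u ihc iht ihu =>
    intro ρ d s hd hρ h
    obtain ⟨s₁, T₁, r₁, a₁, v₁, b₁⟩ := ihc ρ d s hd hρ h
    by_cases hc : c.eval s₀ (ρ.map s.var) = 0
    · obtain ⟨s₂, T₂, r₂, a₂, v₂, b₂⟩ := ihu ρ d s₁ hd hρ (h.trans (a₁.mono hd))
      rw [a₁.map_var hρ] at v₂ b₂
      refine ⟨_, _, .seq r₁ (.ite_false (by simp [Exp.eval, v₁, hc]) r₂), a₁.trans a₂, ?_, ?_⟩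
      · simp [eval, hc, v₂]
      · simp only [time, Exp.cost]; omega
    · obtain ⟨s₂, T₂, r₂, a₂, v₂, b₂⟩ := iht ρ d s₁ hd hρ (h.trans (a₁.mono hd))
      rw [a₁.map_var hρ] at v₂ b₂
      refine ⟨_, _, .seq r₁ (.ite_true (by simp [Exp.eval, v₁, hc]) r₂), a₁.trans a₂, ?_, ?_⟩
      · simp [eval, hc, v₂]
      · simp only [time, Exp.cost]; omega
  | iter b z f ihb ihz ihf =>
    intro ρ d s hd hρ h
    obtain ⟨s₁, T₁, r₁, a₁, v₁, b₁⟩ := ihz ρ d s hd hρ h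
    obtain ⟨s₂, T₂, r₂, a₂, v₂, b₂⟩ := ihb ρ (d + 1) s₁ (by omega)
      (fun x hx => (hρ x hx).trans (by omega)) (h.trans (a₁.mono hd))
    rw [a₁.map_var hρ] at v₂ b₂
    set l := ρ.map s.var with hl
    set N := b.eval s₀ l with hN
    set val := loopVal (fun i acc => f.eval s₀ (acc :: i :: l)) (z.eval s₀ l) with hval
    -- `j` iterations are left
    have key : ∀ (j i : ℕ) (s' : Store), i + j = N → AgreeBelow d s s' → s'.var d = val i →
        s'.var (d + 1) = N → s'.var (d + 2) = i →
        ∃ s'' T, Run (.loop (.sub (.var (d + 1)) (.var (d + 2)))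
          (.seq (f.compile (d :: (d + 2) :: ρ) (d + 3))
            (.seq (.assign d (.var (d + 3)))
              (.assign (d + 2) (.add (.var (d + 2)) (.const 1)))))) s' s'' T ∧
          AgreeBelow d s s'' ∧ s''.var d = val N ∧
          T ≤ 4 + ∑ i ∈ Finset.Ico i N, (f.time s₀ (val i :: i :: l) + 10) := by
      intro j
      induction j with
      | zero =>
        intro i s' hij ha e₀ e₁ e₂
        refine ⟨_, _, .loop_false ?_, ha, ?_, ?_⟩
        · simp [Exp.eval, e₁, e₂]; omega
        · rw [e₀]; congr 1
        · simp [Exp.cost]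
      | succ j ih =>
        intro i s' hij ha e₀ e₁ e₂
        obtain ⟨s₃, T₃, r₃, a₃, v₃, b₃⟩ := ihf (d :: (d + 2) :: ρ) (d + 3) s' (by omega)
          (by
            intro x hx
            simp only [List.mem_cons] at hx
            rcases hx with rfl | rfl | hx
            · omega
            · omega
            · exact (hρ x hx).trans (by omega)) (h.trans (ha.mono hd))
        simp only [List.map_cons, ha.map_var hρ, e₀, e₂, ← hl] at v₃ b₃
        obtain ⟨s₄, T₄, r₄, a₄, v₄, b₄⟩ := ih (i + 1)
          { s₃ with var :=
              Function.update (Function.update s₃.var d (s₃.var (d + 3))) (d + 2) (i + 1) }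
          (by omega)
          ⟨a₃.1.trans ha.1, fun x hx => by
            simp [Function.update_of_ne (show x ≠ d + 2 by omega),
              Function.update_of_ne (show x ≠ d by omega), a₃.2 x (by omega), ha.2 x hx]⟩
          (by simp [v₃]; rfl)
          (by simp [a₃.2 (d + 1) (by omega), e₁])
          (by simp)
        refine ⟨s₄, _, .loop_true (t' := T₄) ?_ (.seq r₃ (.seq (.assign _ _ _) (.assign _ _ _))) ?_,
          a₄, v₄, ?_⟩
        · simp [Exp.eval, e₁, e₂]; omega
        · simpa [Exp.eval, a₃.2 (d + 2) (by omega), e₂] using r₄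
        · rw [Finset.sum_eq_sum_Ico_succ_bot (by omega)]
          simp only [Exp.cost]
          omega
    obtain ⟨s₃, T₃, r₃, a₃, v₃, b₃⟩ := key N 0
      { s₂ with var := Function.update s₂.var (d + 2) 0 } (by omega)
      ((a₁.trans (a₂.mono (by omega))).trans (agreeBelow_update _ _ (by omega)))
      (by simp [a₂.2 d (by omega), v₁, hval, loopVal])
      (by simp [v₂]) (by simp)
    refine ⟨s₃, _, .seq r₁ (.seq r₂ (.seq (.assign _ _ _) r₃)), a₃, v₃, ?_⟩
    simp only [time, Exp.cost, ← hN, ← hval, Finset.range_eq_Ico]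
    omega

end Tm

end RAM

/-! ### Functions computable in polynomial time -/

namespace RAM

namespace Tm

/-- Renaming of the local values. -/
def rename : Tm → (ℕ → ℕ) → Tm
  | const c, _ => const c
  | var x, _ => var x
  | loc i, r => loc (r i)
  | cell a t, r => cell a (t.rename r)
  | add t u, r => add (t.rename r) (u.rename r)
  | sub t u, r => sub (t.rename r) (u.rename r)
  | ite c t u, r => ite (c.rename r) (t.rename r) (u.rename r)
  | iter b z f, r => iter (b.rename r) (z.rename r)
      (f.rename fun i => if i < 2 then i else r (i - 2) + 2)

theorem getD_rename {l l' : List ℕ} {r : ℕ → ℕ} (h : ∀ i, l'.getD (r i) 0 = l.getD i 0) (a b : ℕ) :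
    ∀ i, (a :: b :: l').getD (if i < 2 then i else r (i - 2) + 2) 0 = (a :: b :: l).getD i 0
  | 0 => rfl
  | 1 => rfl
  | i + 2 => by simpa using h i

theorem eval_rename (s : Store) (t : Tm) : ∀ (r : ℕ → ℕ) (l l' : List ℕ),
    (∀ i, l'.getD (r i) 0 = l.getD i 0) → (t.rename r).eval s l' = t.eval s l := by
  induction t with
  | const c => intros; rfl
  | var x => intros; rfl
  | loc i => intro r l l' h; exact h i
  | cell a t ih => intro r l l' h; simp [rename, eval, ih r l l' h]
  | add t u iht ihu => intro r l l' h; simp [rename, eval, iht r l l' h, ihu r l l' h]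
  | sub t u iht ihu => intro r l l' h; simp [rename, eval, iht r l l' h, ihu r l l' h]
  | ite c t u ihc iht ihu =>
    intro r l l' h; simp [rename, eval, ihc r l l' h, iht r l l' h, ihu r l l' h]
  | iter b z f ihb ihz ihf =>
    intro r l l' h
    simp only [rename, eval, ihb r l l' h, ihz r l l' h,
      fun a i => ihf _ (a :: i :: l) (a :: i :: l') (getD_rename h a i)]

theorem time_rename (s : Store) (t : Tm) : ∀ (r : ℕ → ℕ) (l l' : List ℕ),
    (∀ i, l'.getD (r i) 0 = l.getD i 0) → (t.rename r).time s l' = t.time s l := by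
  induction t with
  | const c => intros; rfl
  | var x => intros; rfl
  | loc i => intros; rfl
  | cell a t ih => intro r l l' h; simp [rename, time, ih r l l' h]
  | add t u iht ihu => intro r l l' h; simp [rename, time, iht r l l' h, ihu r l l' h]
  | sub t u iht ihu => intro r l l' h; simp [rename, time, iht r l l' h, ihu r l l' h]
  | ite c t u ihc iht ihu =>
    intro r l l' h; simp [rename, time, ihc r l l' h, iht r l l' h, ihu r l l' h]
  | iter b z f ihb ihz ihf =>
    intro r l l' h
    simp only [rename, time, ihb r l l' h, ihz r l l' h, eval_rename s b r l l' h,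
      eval_rename s z r l l' h,
      fun a i => eval_rename s f _ (a :: i :: l) (a :: i :: l') (getD_rename h a i),
      fun a i => ihf _ (a :: i :: l) (a :: i :: l') (getD_rename h a i)]

end Tm

end RAM

namespace PMatrixApproximation

open RAM

/-- An instance of the problem. -/
structure Inst where
  /-- the number of rows of `A` -/
  m : ℕ
  /-- the number of columns of `A` -/
  n : ℕ
  /-- the number of rows of `P` -/
  p : ℕ
  /-- the number of columns of `P` -/
  q : ℕ
  /-- the number of errors allowed -/
  k : ℕ
  hm : 1 ≤ m
  hn : 1 ≤ n
  hp : 1 ≤ p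
  hq : 1 ≤ q
  /-- the matrix to be approximated -/
  A : Matrix (Fin m) (Fin n) Bool
  /-- the pattern -/
  P : Matrix (Fin p) (Fin q) Bool

/-- The store that holds the instance. -/
def Inst.store (x : Inst) : Store := input x.A x.P x.k

/-- The measure in which running times are polynomial: `2 ^ exponent p q k`, rounded up, times
`n m`. -/
noncomputable def Inst.size (x : Inst) : ℕ := ⌈(2 : ℝ) ^ exponent x.p x.q x.k⌉₊ * (x.n * x.m)

/-- A context: an instance together with local values. -/
class Ctx (Γ : Type) where
  /-- the instance -/
  inst : Γ → Inst
  /-- the local values, innermost first -/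
  loc : Γ → List ℕ

instance : Ctx Inst := ⟨id, fun _ => []⟩

instance {Γ : Type} [Ctx Γ] : Ctx (Γ × ℕ) := ⟨fun y => Ctx.inst y.1, fun y => y.2 :: Ctx.loc y.1⟩

section

variable {Γ : Type} [Ctx Γ]

/-- The size of a context: the size of the instance plus the local values. -/
noncomputable def csize (γ : Γ) : ℕ := (Ctx.inst γ).size + (Ctx.loc γ).sum + 2

theorem two_le_csize (γ : Γ) : 2 ≤ csize γ := by simp [csize]

theorem csize_prod (γ : Γ) (i : ℕ) : csize (γ, i) = csize γ + i := by
  simp [csize, Ctx.inst, Ctx.loc]; omega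

/-- `f` is bounded by a polynomial in the size of the context. -/
def PolyBdd (f : Γ → ℕ) : Prop := ∃ c, ∀ γ, f γ ≤ csize γ ^ c

theorem PolyBdd.mono {f g : Γ → ℕ} (hg : PolyBdd g) (h : ∀ γ, f γ ≤ g γ) : PolyBdd f :=
  hg.imp fun _ hc γ => (h γ).trans (hc γ)

theorem PolyBdd.const (c : ℕ) : PolyBdd fun _ : Γ => c :=
  ⟨c, fun γ => Nat.lt_two_pow_self.le.trans (Nat.pow_le_pow_left (two_le_csize γ) c)⟩

theorem PolyBdd.mul {f g : Γ → ℕ} (hf : PolyBdd f) (hg : PolyBdd g) :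
    PolyBdd fun γ => f γ * g γ := by
  obtain ⟨a, ha⟩ := hf
  obtain ⟨b, hb⟩ := hg
  exact ⟨a + b, fun γ => (Nat.mul_le_mul (ha γ) (hb γ)).trans (pow_add _ _ _).ge⟩

theorem PolyBdd.add {f g : Γ → ℕ} (hf : PolyBdd f) (hg : PolyBdd g) :
    PolyBdd fun γ => f γ + g γ := by
  obtain ⟨a, ha⟩ := hf
  obtain ⟨b, hb⟩ := hg
  refine ⟨a + b + 1, fun γ => ?_⟩
  have h2 := two_le_csize γ
  have h₁ := (ha γ).trans (Nat.pow_le_pow_right (by omega) (Nat.le_add_right a b))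
  have h₂ := (hb γ).trans (Nat.pow_le_pow_right (by omega) (Nat.le_add_left b a))
  rw [pow_succ]
  nlinarith

theorem PolyBdd.pow {f : Γ → ℕ} (hf : PolyBdd f) (c : ℕ) : PolyBdd fun γ => f γ ^ c := by
  obtain ⟨a, ha⟩ := hf
  exact ⟨a * c, fun γ => (Nat.pow_le_pow_left (ha γ) c).trans (pow_mul _ _ _).ge⟩

theorem polyBdd_csize : PolyBdd fun γ : Γ => csize γ := ⟨1, fun _ => (pow_one _).ge⟩

/-- `f` takes polynomially bounded values and is computed by a term in polynomial time. -/
def PT (f : Γ → ℕ) : Prop :=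
  PolyBdd f ∧ ∃ t : Tm, (∀ γ, t.eval (Ctx.inst γ).store (Ctx.loc γ) = f γ) ∧
    PolyBdd fun γ : Γ => t.time (Ctx.inst γ).store (Ctx.loc γ)

/-- `φ` is decided by a term in polynomial time. -/
def PD (φ : Γ → Prop) : Prop := ∃ f : Γ → ℕ, PT f ∧ ∀ γ, f γ ≠ 0 ↔ φ γ

theorem PT.congr {f g : Γ → ℕ} (hf : PT f) (h : ∀ γ, f γ = g γ) : PT g := funext h ▸ hf

theorem PD.congr {φ ψ : Γ → Prop} (hφ : PD φ) (h : ∀ γ, φ γ ↔ ψ γ) : PD ψ :=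
  hφ.imp fun _ hf => ⟨hf.1, fun γ => (hf.2 γ).trans (h γ)⟩

theorem PT.const (c : ℕ) : PT fun _ : Γ => c :=
  ⟨.const c, .const c, fun _ => rfl, .const 2⟩

theorem PT.snd : PT fun y : Γ × ℕ => y.2 :=
  ⟨polyBdd_csize.mono fun y => by rw [← Prod.mk.eta (p := y), csize_prod]; omega,
    .loc 0, fun _ => rfl, .const 2⟩

/-- Change of context along a map that only forgets and rearranges local values. -/
theorem PT.comp {Δ : Type} [Ctx Δ] {f : Γ → ℕ} (hf : PT f) (π : Δ → Γ) (r : ℕ → ℕ)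
    (h₁ : ∀ δ, Ctx.inst (π δ) = Ctx.inst δ)
    (h₂ : ∀ δ i, (Ctx.loc δ).getD (r i) 0 = (Ctx.loc (π δ)).getD i 0)
    (h₃ : ∀ δ, csize (π δ) ≤ csize δ) : PT fun δ => f (π δ) := by
  obtain ⟨⟨b, hb⟩, t, ht, c, hc⟩ := hf
  refine ⟨⟨b, fun δ => (hb (π δ)).trans (Nat.pow_le_pow_left (h₃ δ) b)⟩, t.rename r,
    fun δ => ?_, c, fun δ => ?_⟩
  · rw [Tm.eval_rename _ t _ _ _ (h₂ δ), ← h₁, ht]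
  · dsimp only
    rw [Tm.time_rename _ t _ _ _ (h₂ δ), ← h₁]
    exact (hc (π δ)).trans (Nat.pow_le_pow_left (h₃ δ) c)

/-- Weakening by the innermost local value. -/
theorem PT.fst {f : Γ → ℕ} (hf : PT f) : PT fun y : Γ × ℕ => f y.1 :=
  hf.comp (fun y : Γ × ℕ => y.1) (· + 1) (fun _ => rfl) (fun _ _ => rfl) fun y =>
    (Nat.le_add_right _ _).trans_eq (csize_prod y.1 y.2).symm

/-- Weakening by the second innermost local value. -/
theorem PT.skip {f : Γ × ℕ → ℕ} (hf : PT f) : PT fun y : (Γ × ℕ) × ℕ => f (y.1.1, y.2) :=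
  hf.comp (fun y : (Γ × ℕ) × ℕ => (y.1.1, y.2)) (fun i => if i = 0 then 0 else i + 1)
    (fun _ => rfl) (fun _ i => by cases i <;> rfl) fun y => by
      rw [← Prod.mk.eta (p := y), ← Prod.mk.eta (p := y.1)]
      simp only [csize_prod]
      omega

theorem PT.add {f g : Γ → ℕ} (hf : PT f) (hg : PT g) : PT fun γ => f γ + g γ := by
  obtain ⟨hf, t, ht, hT⟩ := hf
  obtain ⟨hg, u, hu, hU⟩ := hg
  exact ⟨hf.add hg, .add t u, fun γ => by simp [Tm.eval, ht, hu], (hT.add hU).add (.const 4)⟩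

theorem PT.sub {f g : Γ → ℕ} (hf : PT f) (hg : PT g) : PT fun γ => f γ - g γ := by
  obtain ⟨hf, t, ht, hT⟩ := hf
  obtain ⟨hg, u, hu, hU⟩ := hg
  exact ⟨hf.mono fun _ => Nat.sub_le _ _, .sub t u, fun γ => by simp [Tm.eval, ht, hu],
    (hT.add hU).add (.const 4)⟩

theorem PT.ite {φ : Γ → Prop} {f g : Γ → ℕ} [DecidablePred φ] (hφ : PD φ) (hf : PT f)
    (hg : PT g) : PT fun γ => if φ γ then f γ else g γ := by
  obtain ⟨e, ⟨he, c, hc, hC⟩, h⟩ := hφ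
  obtain ⟨hf, t, ht, hT⟩ := hf
  obtain ⟨hg, u, hu, hU⟩ := hg
  refine ⟨(hf.add hg).mono fun γ => ?_, .ite c t u, fun γ => ?_,
    ((hC.add hT).add hU).add (.const 2)⟩
  · split_ifs <;> omega
  · simp only [Tm.eval, hc, ht, hu, h]

/-- Loops take polynomial time if the values of the accumulator are polynomially bounded. -/
theorem PT.iter {g z : Γ → ℕ} {f : Γ → ℕ → ℕ → ℕ} (hg : PT g) (hz : PT z)
    (hf : PT fun y : (Γ × ℕ) × ℕ => f y.1.1 y.1.2 y.2) {B : Γ → ℕ} (hB : PolyBdd B)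
    (h : ∀ γ, ∀ i ≤ g γ, loopVal (f γ) (z γ) i ≤ B γ) :
    PT fun γ => loopVal (f γ) (z γ) (g γ) := by
  obtain ⟨hg, t, ht, hT⟩ := hg
  obtain ⟨hz, u, hu, hU⟩ := hz
  obtain ⟨-, v, hv, c, hc⟩ := hf
  have hv' (γ : Γ) (i acc : ℕ) : v.eval (Ctx.inst γ).store (acc :: i :: Ctx.loc γ) = f γ i acc :=
    hv ((γ, i), acc)
  refine ⟨hB.mono fun γ => h γ _ le_rfl, .iter t u v, fun γ => ?_, ?_⟩
  · simp only [Tm.eval, ht, hu, hv']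
  · refine PolyBdd.mono (((hU.add hT).add (.const 6)).add
      (hg.mul ((((polyBdd_csize.add hg).add hB).pow c).add (.const 10)))) fun γ => ?_
    simp only [Tm.time, ht, hu, hv']
    refine Nat.add_le_add_left ((Finset.sum_le_card_nsmul _ _ _ fun i hi => ?_).trans_eq
      (by rw [Finset.card_range, smul_eq_mul])) _
    have hi := (Finset.mem_range.1 hi).le
    refine Nat.add_le_add_right ((hc ((γ, i), loopVal (f γ) (z γ) i)).trans
      (Nat.pow_le_pow_left ?_ c)) _
    have := h γ i hi
    rw [csize_prod, csize_prod]
    omega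

theorem loopVal_add (f : ℕ → ℕ) (b : ℕ) :
    loopVal (fun i acc => acc + f i) 0 b = ∑ i ∈ Finset.range b, f i := by
  induction b with
  | zero => rfl
  | succ b ih => rw [Finset.sum_range_succ, ← ih]; rfl

theorem PT.sum {g : Γ → ℕ} {f : Γ → ℕ → ℕ} (hg : PT g) (hf : PT fun y : Γ × ℕ => f y.1 y.2) :
    PT fun γ => ∑ i ∈ Finset.range (g γ), f γ i := by
  obtain ⟨c, hc⟩ := hf.1
  refine PT.congr (PT.iter (f := fun γ i acc => acc + f γ i) hg (.const 0) (PT.snd.add hf.fst)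
    (hg.1.mul ((polyBdd_csize.add hg.1).pow c)) fun γ i hi => ?_) fun γ => loopVal_add _ _
  rw [loopVal_add]
  refine (Finset.sum_le_card_nsmul _ _ ((csize γ + g γ) ^ c) fun j hj => ?_).trans ?_
  · refine (hc (γ, j)).trans (Nat.pow_le_pow_left ?_ c)
    have := Finset.mem_range.1 hj
    rw [csize_prod]
    omega
  · rw [Finset.card_range, smul_eq_mul]
    exact Nat.mul_le_mul_right _ hi

theorem PT.mul {f g : Γ → ℕ} (hf : PT f) (hg : PT g) : PT fun γ => f γ * g γ :=
  (PT.sum (f := fun γ _ => g γ) hf hg.fst).congr fun γ => by simp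

theorem loopVal_mul (b e : ℕ) : loopVal (fun _ acc => acc * b) 1 e = b ^ e := by
  induction e with
  | zero => rfl
  | succ e ih => rw [pow_succ, ← ih]; rfl

/-- Powers are computed in polynomial time as long as they are polynomially bounded. -/
theorem PT.pow {f g : Γ → ℕ} (hf : PT f) (hg : PT g) (h : PolyBdd fun γ => f γ ^ g γ) :
    PT fun γ => f γ ^ g γ := by
  refine PT.congr (PT.iter (f := fun γ _ acc => acc * f γ) hg (.const 1) (PT.snd.mul hf.fst.fst)
    (h.add (.const 1)) fun γ i hi => ?_) fun γ => loopVal_mul _ _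
  rw [loopVal_mul]
  rcases Nat.eq_zero_or_pos (f γ) with h0 | h0
  · rw [h0]
    exact (pow_le_one₀ le_rfl zero_le_one).trans (Nat.le_add_left 1 _)
  · exact (Nat.pow_le_pow_right h0 hi).trans (by omega)

theorem PT.pd {f : Γ → ℕ} (hf : PT f) : PD fun γ => f γ ≠ 0 := ⟨f, hf, fun _ => Iff.rfl⟩

theorem PD.lt {f g : Γ → ℕ} (hf : PT f) (hg : PT g) : PD fun γ => f γ < g γ :=
  (hg.sub hf).pd.congr fun _ => by omega

theorem PD.not {φ : Γ → Prop} (hφ : PD φ) : PD fun γ => ¬ φ γ := by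
  obtain ⟨f, hf, h⟩ := hφ
  refine (PD.lt hf (.const 1)).congr fun γ => ?_
  rw [← h γ]
  omega

theorem PD.and {φ ψ : Γ → Prop} (hφ : PD φ) (hψ : PD ψ) : PD fun γ => φ γ ∧ ψ γ := by
  obtain ⟨f, hf, h⟩ := hφ
  obtain ⟨g, hg, h'⟩ := hψ
  refine (hf.mul hg).pd.congr fun γ => ?_
  rw [← h γ, ← h' γ, mul_ne_zero_iff]

theorem PD.or {φ ψ : Γ → Prop} (hφ : PD φ) (hψ : PD ψ) : PD fun γ => φ γ ∨ ψ γ :=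
  (hφ.not.and hψ.not).not.congr fun _ => by tauto

theorem PD.imp {φ ψ : Γ → Prop} (hφ : PD φ) (hψ : PD ψ) : PD fun γ => φ γ → ψ γ :=
  (hφ.not.or hψ).congr fun _ => by tauto

theorem PD.iff {φ ψ : Γ → Prop} (hφ : PD φ) (hψ : PD ψ) : PD fun γ => (φ γ ↔ ψ γ) :=
  ((hφ.imp hψ).and (hψ.imp hφ)).congr fun _ => by tauto

theorem PD.le {f g : Γ → ℕ} (hf : PT f) (hg : PT g) : PD fun γ => f γ ≤ g γ :=
  (PD.lt hg hf).not.congr fun _ => not_lt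

theorem PD.eq {f g : Γ → ℕ} (hf : PT f) (hg : PT g) : PD fun γ => f γ = g γ :=
  ((PD.le hf hg).and (PD.le hg hf)).congr fun _ => le_antisymm_iff.symm

theorem PD.ex {g : Γ → ℕ} {φ : Γ → ℕ → Prop} (hg : PT g) (hφ : PD fun y : Γ × ℕ => φ y.1 y.2) :
    PD fun γ => ∃ i < g γ, φ γ i := by
  obtain ⟨f, hf, h⟩ := hφ
  refine (PT.sum (f := fun γ i => f (γ, i)) hg hf).pd.congr fun γ => ?_
  simp only [ne_eq, Finset.sum_eq_zero_iff, Finset.mem_range, not_forall, exists_prop]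
  exact exists_congr fun i => and_congr_right fun _ => h (γ, i)

theorem PD.all {g : Γ → ℕ} {φ : Γ → ℕ → Prop} (hg : PT g) (hφ : PD fun y : Γ × ℕ => φ y.1 y.2) :
    PD fun γ => ∀ i < g γ, φ γ i :=
  (PD.ex (φ := fun γ i => ¬ φ γ i) hg hφ.not).not.congr fun _ => by push Not; rfl

theorem PT.count {g : Γ → ℕ} {φ : Γ → ℕ → Prop} [∀ γ, DecidablePred (φ γ)] (hg : PT g)
    (hφ : PD fun y : Γ × ℕ => φ y.1 y.2) :
    PT fun γ => ((Finset.range (g γ)).filter (φ γ)).card :=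
  (PT.sum hg (PT.ite hφ (.const 1) (.const 0))).congr fun _ => (Finset.card_filter _ _).symm

theorem PT.div {f g : Γ → ℕ} (hf : PT f) (hg : PT g) : PT fun γ => f γ / g γ := by
  refine (PT.ite (PD.eq hg (.const 0)) (.const 0) (PT.count
    (φ := fun γ i => (i + 1) * g γ ≤ f γ) hf
    (PD.le ((PT.snd.add (.const 1)).mul hg.fst) hf.fst))).congr fun γ => ?_
  split_ifs with h
  · simp [h]
  · rw [← Finset.card_range (f γ / g γ)]
    congr 1
    ext i
    simp only [Finset.mem_filter, Finset.mem_range, ← Nat.le_div_iff_mul_le (Nat.pos_of_ne_zero h)]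
    have := Nat.div_le_self (f γ) (g γ)
    omega

theorem PT.mod {f g : Γ → ℕ} (hf : PT f) (hg : PT g) : PT fun γ => f γ % g γ :=
  (hf.sub (hg.mul (hf.div hg))).congr fun _ => (Nat.mod_eq_sub _ _).symm

theorem PT.sqrt {f : Γ → ℕ} (hf : PT f) : PT fun γ => Nat.sqrt (f γ) := by
  refine (PT.count (φ := fun γ i => (i + 1) * (i + 1) ≤ f γ) hf
    (PD.le ((PT.snd.add (.const 1)).mul (PT.snd.add (.const 1))) hf.fst)).congr fun γ => ?_
  rw [← Finset.card_range (Nat.sqrt (f γ))]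
  congr 1
  ext i
  simp only [Finset.mem_filter, Finset.mem_range, ← Nat.le_sqrt]
  have := Nat.sqrt_le_self (f γ)
  omega

theorem loopVal_min_mul {b h : ℕ} (hb : 1 ≤ b) (e : ℕ) :
    loopVal (fun _ acc => if acc * b < h then acc * b else h) (if 1 < h then 1 else h) e =
      min (b ^ e) h := by
  induction e with
  | zero => rw [loopVal, pow_zero]; split_ifs <;> omega
  | succ e ih =>
    rw [loopVal, ih, pow_succ]
    rcases le_total (b ^ e) h with h1 | h1
    · rw [min_eq_left h1]
      split_ifs with h2 <;> omega
    · have : h ≤ h * b := Nat.le_mul_of_pos_right h hb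
      have : h * b ≤ b ^ e * b := Nat.mul_le_mul_right b h1
      rw [min_eq_right h1]
      split_ifs with h2 <;> omega

/-- Powers of positive numbers cut off at a polynomially bounded value. -/
theorem PT.pow_min {f g h : Γ → ℕ} (hf : PT f) (hg : PT g) (hh : PT h) (hpos : ∀ γ, 1 ≤ f γ) :
    PT fun γ => min (f γ ^ g γ) (h γ) := by
  have hm : PT fun y : (Γ × ℕ) × ℕ => y.2 * f y.1.1 := PT.snd.mul hf.fst.fst
  refine (PT.iter (f := fun γ _ acc => if acc * f γ < h γ then acc * f γ else h γ) hg
    (PT.ite (PD.lt (.const 1) hh) (.const 1) hh) (PT.ite (PD.lt hm hh.fst.fst) hm hh.fst.fst)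
    hh.1 fun γ i _ => ?_).congr fun γ => loopVal_min_mul (hpos γ) _
  rw [loopVal_min_mul (hpos γ)]
  exact min_le_right _ _

theorem PT.log_two {f : Γ → ℕ} (hf : PT f) : PT fun γ => Nat.log 2 (f γ) := by
  refine (PT.count (φ := fun γ i => min (2 ^ (i + 1)) (f γ + 1) ≤ f γ) hf
    (PD.le (PT.pow_min (f := fun _ => 2) (.const 2) (PT.snd.add (.const 1))
    (hf.fst.add (.const 1)) (by simp)) hf.fst)).congr fun γ => ?_
  rw [← Finset.card_range (Nat.log 2 (f γ))]
  congr 1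
  ext i
  have h1 : min (2 ^ (i + 1)) (f γ + 1) ≤ f γ ↔ 2 ^ (i + 1) ≤ f γ := by omega
  simp only [Finset.mem_filter, Finset.mem_range]
  rw [h1]
  rcases Nat.eq_zero_or_pos (f γ) with h0 | h0
  · simp [h0]
  · rw [← Nat.le_log_iff_pow_le (by norm_num) h0.ne']
    have := Nat.log_lt_self 2 h0.ne'
    omega

/-- The number of `i < b` with `φ i`. -/
noncomputable def numBelow (b : ℕ) (φ : ℕ → Prop) : ℕ := by
  classical exact ((Finset.range b).filter φ).card

theorem numBelow_eq (b : ℕ) (φ : ℕ → Prop) [DecidablePred φ] :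
    numBelow b φ = ((Finset.range b).filter φ).card := by
  rw [numBelow]; congr

theorem PT.numBelow {g : Γ → ℕ} {φ : Γ → ℕ → Prop} (hg : PT g)
    (hφ : PD fun y : Γ × ℕ => φ y.1 y.2) : PT fun γ => numBelow (g γ) (φ γ) := by
  classical exact PT.count hg hφ

/-- The least `i < b` with `φ i`, and `b` if there is none. -/
noncomputable def least (b : ℕ) (φ : ℕ → Prop) : ℕ := numBelow b fun i => ∀ j < i + 1, ¬ φ j

theorem least_spec {b : ℕ} {φ : ℕ → Prop} (h : ∃ i < b, φ i) : least b φ < b ∧ φ (least b φ) := by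
  classical
  obtain ⟨hb, hφ⟩ := Nat.find_spec h
  have : least b φ = Nat.find h := by
    rw [least, numBelow_eq, ← Finset.card_range (Nat.find h)]
    congr 1
    ext i
    simp only [Finset.mem_filter, Finset.mem_range]
    constructor
    · rintro ⟨-, hi⟩
      by_contra! hlt
      exact hi _ (by omega) hφ
    · exact fun hi => ⟨hi.trans hb, fun j hj hφj => Nat.find_min h (by omega : j < Nat.find h)
        ⟨by omega, hφj⟩⟩
  rw [this]
  exact ⟨hb, hφ⟩

theorem PT.least {g : Γ → ℕ} {φ : Γ → ℕ → Prop} (hg : PT g)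
    (hφ : PD fun y : Γ × ℕ => φ y.1 y.2) : PT fun γ => least (g γ) (φ γ) := by
  obtain ⟨f, hf, h⟩ := hφ
  have hφ' : PD fun y : (Γ × ℕ) × ℕ => φ y.1.1 y.2 := ⟨_, hf.skip, fun y => h _⟩
  exact PT.numBelow hg (PD.all (φ := fun y j => ¬ φ y.1 j) (PT.snd.add (.const 1)) hφ'.not)

end

end PMatrixApproximation

/-! ### Bounds for the number of guesses -/

namespace PMatrixApproximation

open Real

namespace Inst

variable (x : Inst)

/-- The number of errors up to which a column counts as near to its pattern, about
`√(k / log (p + k))`. -/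
def delta : ℕ := Nat.sqrt (x.k / Nat.log 2 (x.p + x.k))

/-- A bound for the number of columns with more than `delta` errors, at most
`√(k log (p + k))`. -/
def farBound : ℕ := x.k / (x.delta + 1)

/-- `2 ^ exponent p q k`, rounded up. -/
noncomputable def budget : ℕ := ⌈(2 : ℝ) ^ exponent x.p x.q x.k⌉₊

theorem one_le_budget : 1 ≤ x.budget := Nat.ceil_pos.2 (by positivity)

theorem size_eq : x.size = x.budget * (x.n * x.m) := rfl

theorem budget_le_size : x.budget ≤ x.size :=
  Nat.le_mul_of_pos_right _ (Nat.mul_pos x.hn x.hm)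

theorem m_le_size : x.m ≤ x.size := by
  rw [size_eq, ← mul_assoc]
  exact Nat.le_mul_of_pos_left _ (Nat.mul_pos x.one_le_budget x.hn)

theorem n_le_size : x.n ≤ x.size := by
  rw [size_eq, mul_left_comm]
  exact Nat.le_mul_of_pos_right _ (Nat.mul_pos x.one_le_budget x.hm)

theorem logb_nat_nonneg (a : ℕ) : 0 ≤ logb 2 a := by
  rcases Nat.eq_zero_or_pos a with rfl | h
  · simp
  · exact logb_nonneg (by norm_num) (by exact_mod_cast h)

theorem logb_p_add_nonneg : 0 ≤ logb 2 ((x.p : ℝ) + x.k) := by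
  exact_mod_cast logb_nat_nonneg (x.p + x.k)

theorem logb_q_add_nonneg : 0 ≤ logb 2 ((x.q : ℝ) + x.k) := by
  exact_mod_cast logb_nat_nonneg (x.q + x.k)

/-- Each part of the exponent is bounded by the whole. -/
theorem exponent_parts :
    (x.p : ℝ) * √(x.k * logb 2 (x.p + x.k)) + x.p * logb 2 x.p ≤ exponent x.p x.q x.k ∧
    (x.q : ℝ) * √(x.k * logb 2 (x.p + x.k)) ≤ exponent x.p x.q x.k ∧
    (x.q : ℝ) * logb 2 x.q ≤ exponent x.p x.q x.k ∧
    (x.q : ℝ) * logb 2 (x.q + x.k) ≤ exponent x.p x.q x.k := by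
  have h1 : 0 ≤ (x.p : ℝ) * √(x.k * logb 2 (x.p + x.k)) := by positivity
  have h2 : 0 ≤ (x.q : ℝ) * √(x.k * logb 2 (x.p + x.k)) := by positivity
  have h3 := mul_nonneg (Nat.cast_nonneg (α := ℝ) x.p) (logb_nat_nonneg x.p)
  have h4 := mul_nonneg (Nat.cast_nonneg (α := ℝ) x.q) (logb_nat_nonneg x.q)
  have h5 := mul_nonneg (Nat.cast_nonneg (α := ℝ) x.q) x.logb_q_add_nonneg
  rw [exponent, add_mul]
  refine ⟨?_, ?_, ?_, ?_⟩ <;> linarith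

theorem pow_le_budget {b e c : ℕ} (hb : 1 ≤ b) (h : (e : ℝ) * logb 2 b ≤ c * exponent x.p x.q x.k) :
    b ^ e ≤ x.budget ^ c := by
  have hb' : (0 : ℝ) < b := by exact_mod_cast hb
  have : ((b ^ e : ℕ) : ℝ) ≤ ((x.budget ^ c : ℕ) : ℝ) := by
    calc ((b ^ e : ℕ) : ℝ) = (2 : ℝ) ^ ((e : ℝ) * logb 2 b) := by
          rw [mul_comm, rpow_mul (by norm_num), rpow_logb (by norm_num) (by norm_num) hb',
            rpow_natCast, Nat.cast_pow]
      _ ≤ (2 : ℝ) ^ (exponent x.p x.q x.k * c) :=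
          rpow_le_rpow_of_exponent_le (by norm_num) (by linarith)
      _ = ((2 : ℝ) ^ exponent x.p x.q x.k) ^ c := by rw [rpow_mul (by norm_num), rpow_natCast]
      _ ≤ ((x.budget ^ c : ℕ) : ℝ) := by
          rw [Nat.cast_pow]
          exact pow_le_pow_left₀ (by positivity) (Nat.le_ceil _) c
  exact_mod_cast this

theorem le_budget_of_mul {a b : ℕ} (ha : 1 ≤ a) (hb : 1 ≤ b)
    (h : (b : ℝ) * logb 2 a ≤ exponent x.p x.q x.k) : a ≤ x.budget := by
  have hb' : (1 : ℝ) ≤ b := by exact_mod_cast hb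
  have := x.pow_le_budget (e := 1) (c := 1) ha (by
    have := le_mul_of_one_le_left (logb_nat_nonneg a) hb'
    push_cast
    linarith)
  simpa using this

theorem p_le_budget : x.p ≤ x.budget :=
  x.le_budget_of_mul x.hp x.hp
    (le_trans (le_add_of_nonneg_left (by positivity)) x.exponent_parts.1)

theorem q_le_budget : x.q ≤ x.budget := x.le_budget_of_mul x.hq x.hq x.exponent_parts.2.2.1

theorem k_le_budget : x.k ≤ x.budget :=
  (Nat.le_add_left _ _).trans (x.le_budget_of_mul (a := x.q + x.k) (Nat.le_add_right_of_le x.hq)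
    x.hq (by exact_mod_cast x.exponent_parts.2.2.2))

theorem colReps_bound : ((x.q + x.k) ^ 2) ^ x.q ≤ x.budget ^ 2 := by
  rw [← pow_mul]
  refine x.pow_le_budget (Nat.le_add_right_of_le x.hq) ?_
  have := x.exponent_parts.2.2.2
  push_cast
  linarith

theorem logb_p_add_le :
    logb 2 ((x.p : ℝ) + x.k) ≤ logb 2 x.p + √(x.k * logb 2 (x.p + x.k)) := by
  set l := logb 2 ((x.p : ℝ) + x.k) with hl
  have hl0 : 0 ≤ l := x.logb_p_add_nonneg
  rcases le_total l x.k with h | h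
  · have : l ≤ √(x.k * l) := le_sqrt_of_sq_le (by nlinarith)
    have := logb_nat_nonneg x.p
    linarith
  · have h1 : (x.k : ℝ) ≤ √(x.k * l) := le_sqrt_of_sq_le (by
      have := Nat.cast_nonneg (α := ℝ) x.k
      nlinarith)
    have hp : (1 : ℝ) ≤ x.p := by exact_mod_cast x.hp
    have h2 : l ≤ logb 2 (x.p * 2 ^ x.k) := by
      refine logb_le_logb_of_le (by norm_num) (by positivity) ?_
      have : (x.k : ℝ) + 1 ≤ 2 ^ x.k := by exact_mod_cast Nat.lt_two_pow_self
      have := Nat.cast_nonneg (α := ℝ) x.k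
      nlinarith
    rw [logb_mul (by positivity) (by positivity), logb_pow, logb_self_eq_one (by norm_num)] at h2
    linarith

theorem rowReps_bound : ((x.p + x.k) ^ 2) ^ x.p ≤ x.budget ^ 2 := by
  rw [← pow_mul]
  refine x.pow_le_budget (Nat.le_add_right_of_le x.hp) ?_
  have h1 := x.exponent_parts.1
  have h2 := mul_le_mul_of_nonneg_left x.logb_p_add_le (Nat.cast_nonneg (α := ℝ) x.p)
  push_cast
  linarith

theorem good_bound : 2 ^ x.q ≤ 2 * x.budget := by
  rcases Nat.lt_or_ge x.q 2 with h | h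
  · have : x.q = 1 := by have := x.hq; omega
    have := x.one_le_budget
    rw [‹x.q = 1›]
    omega
  · have := x.pow_le_budget (b := x.q) (e := x.q) (c := 1) x.hq
      (by simpa using x.exponent_parts.2.2.1)
    have := Nat.pow_le_pow_left h x.q
    rw [pow_one] at *
    omega

theorem log_bounds (hk : 1 ≤ x.k) :
    1 ≤ Nat.log 2 (x.p + x.k) ∧ (Nat.log 2 (x.p + x.k) : ℝ) ≤ logb 2 ((x.p : ℝ) + x.k) ∧
      logb 2 ((x.p : ℝ) + x.k) ≤ 2 * Nat.log 2 (x.p + x.k) := by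
  have hp := x.hp
  have h1 : 1 ≤ Nat.log 2 (x.p + x.k) := Nat.log_pos (by norm_num) (by omega)
  refine ⟨h1, by exact_mod_cast natLog_le_logb (x.p + x.k) 2, ?_⟩
  have h2 : ((x.p + x.k : ℕ) : ℝ) ≤ (2 : ℝ) ^ (Nat.log 2 (x.p + x.k) + 1) := by
    exact_mod_cast (Nat.lt_pow_succ_log_self (by norm_num) (x.p + x.k)).le
  have h3 := logb_le_logb_of_le (b := 2) (by norm_num) (by
    have : 0 < x.p + x.k := by omega
    exact_mod_cast this) h2
  rw [logb_pow, logb_self_eq_one (by norm_num)] at h3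
  have h4 : (1 : ℝ) ≤ Nat.log 2 (x.p + x.k) := by exact_mod_cast h1
  push_cast at h3
  linarith

theorem flips_bound : ((x.p + x.k) ^ 2 + 1) ^ (x.q * x.delta) ≤ x.budget ^ 6 := by
  rcases Nat.eq_zero_or_pos x.k with hk | hk
  · have : x.delta = 0 := by simp [delta, hk]
    rw [this]
    simpa using Nat.one_le_pow _ _ x.one_le_budget
  have hp := x.hp
  obtain ⟨h1, h2, h3⟩ := x.log_bounds hk
  set l := logb 2 ((x.p : ℝ) + x.k) with hl
  have hl0 : 0 ≤ l := x.logb_p_add_nonneg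
  have hb : (x.p + x.k) ^ 2 + 1 ≤ (x.p + x.k) ^ 3 := by
    have : 2 ≤ x.p + x.k := by omega
    nlinarith [Nat.pow_le_pow_left this 2]
  refine (Nat.pow_le_pow_left hb _).trans ?_
  rw [← pow_mul]
  refine x.pow_le_budget (by omega) ?_
  have hd : (x.delta : ℝ) ^ 2 * Nat.log 2 (x.p + x.k) ≤ x.k := by
    have := Nat.mul_le_of_le_div _ _ _ (Nat.sqrt_le' (x.k / Nat.log 2 (x.p + x.k)))
    exact_mod_cast this
  have hd' : x.delta * l ≤ 2 * √(x.k * l) := by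
    have : x.delta * l ≤ √(4 * (x.k * l)) := by
      refine le_sqrt_of_sq_le ?_
      have : (x.delta : ℝ) ^ 2 * l ≤ 2 * x.k := by nlinarith [sq_nonneg (x.delta : ℝ)]
      nlinarith [mul_le_mul_of_nonneg_right this hl0, mul_nonneg (Nat.cast_nonneg (α := ℝ) x.k) hl0]
    rwa [sqrt_mul (by norm_num), show (4 : ℝ) = 2 ^ 2 by norm_num, sqrt_sq (by norm_num)] at this
  have := mul_le_mul_of_nonneg_left hd' (Nat.cast_nonneg (α := ℝ) x.q)
  have := x.exponent_parts.2.1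
  push_cast
  rw [← hl] at *
  linarith

theorem far_bound : x.q ^ x.farBound ≤ x.budget := by
  have hq : x.q ^ x.farBound ≤ 2 ^ (x.q * x.farBound) := by
    rw [pow_mul]
    exact Nat.pow_le_pow_left Nat.lt_two_pow_self.le _
  refine hq.trans ((x.pow_le_budget (c := 1) (by norm_num) ?_).trans_eq (pow_one _))
  rcases Nat.eq_zero_or_pos x.k with hk | hk
  · have h0 : x.farBound = 0 := by simp [farBound, hk]
    rw [h0]
    have := x.exponent_parts.2.1
    have : 0 ≤ (x.q : ℝ) * √(x.k * logb 2 (x.p + x.k)) := by positivity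
    push_cast
    linarith
  obtain ⟨h1, h2, h3⟩ := x.log_bounds hk
  set l := logb 2 ((x.p : ℝ) + x.k) with hl
  have ha : x.farBound * (x.delta + 1) ≤ x.k := Nat.div_mul_le_self _ _
  have hb : x.k ≤ (x.delta + 1) ^ 2 * Nat.log 2 (x.p + x.k) := by
    have := Nat.lt_succ_sqrt' (x.k / Nat.log 2 (x.p + x.k))
    exact ((Nat.div_lt_iff_lt_mul h1).1 this).le
  have hc : x.farBound ^ 2 ≤ x.k * Nat.log 2 (x.p + x.k) := by
    have : (x.delta + 1) ^ 2 * x.farBound ^ 2 ≤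
        (x.delta + 1) ^ 2 * (x.k * Nat.log 2 (x.p + x.k)) := by
      calc (x.delta + 1) ^ 2 * x.farBound ^ 2 = (x.farBound * (x.delta + 1)) ^ 2 := by ring
        _ ≤ x.k ^ 2 := Nat.pow_le_pow_left ha 2
        _ = x.k * x.k := sq _
        _ ≤ x.k * ((x.delta + 1) ^ 2 * Nat.log 2 (x.p + x.k)) := Nat.mul_le_mul_left _ hb
        _ = _ := by ring
    exact Nat.le_of_mul_le_mul_left this (by positivity)
  have hd : (x.farBound : ℝ) ≤ √(x.k * l) := by
    refine le_sqrt_of_sq_le (le_trans (?_ : _ ≤ (x.k : ℝ) * Nat.log 2 (x.p + x.k)) ?_)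
    · exact_mod_cast hc
    · exact mul_le_mul_of_nonneg_left h2 (Nat.cast_nonneg _)
  have := mul_le_mul_of_nonneg_left hd (Nat.cast_nonneg (α := ℝ) x.q)
  have h5 := x.exponent_parts.2.1
  rw [← hl] at h5
  rw [Nat.cast_ofNat, logb_self_eq_one (by norm_num)]
  push_cast
  linarith

end Inst

end PMatrixApproximation

/-! ### The algorithm -/

namespace PMatrixApproximation

/-- The `i`-th digit of `c` in base `R`. -/
def digit (R i c : ℕ) : ℕ := c / R ^ i % R

/-- A guess: five numbers, each of which encodes a sequence of digits. -/
structure Guess where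
  /-- for each column class, the index of a representative -/
  colReps : ℕ
  /-- for each column class, the indices of the rows in which the representative is wrong -/
  flips : ℕ
  /-- for each column class, whether it has a column with at most `delta` errors -/
  good : ℕ
  /-- the classes of the far columns -/
  far : ℕ
  /-- for each row class, the index of a representative -/
  rowReps : ℕ

namespace Inst

variable (x : Inst) (g : Guess)

/-- The entries of `A`, with zeros outside. -/
def a (s t : ℕ) : ℕ := rowMajor x.A (s * x.n + t)

/-- The entries of `P`, with zeros outside. -/
def b (i j : ℕ) : ℕ := rowMajor x.P (i * x.q + j)

/-- The rows `s` and `s'` of `A` are equal. -/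
def RowEq (s s' : ℕ) : Prop := ∀ t < x.n, x.a s t = x.a s' t

/-- The columns `t` and `t'` of `A` are equal. -/
def ColEq (t t' : ℕ) : Prop := ∀ s < x.m, x.a s t = x.a s t'

/-- Among the rows equal to it, the row `s` is one of the first `p + k`. -/
def RowCand (s : ℕ) : Prop := numBelow s (fun s' => x.RowEq s' s) < x.p + x.k

/-- Among the columns equal to it, the column `t` is one of the first `q + k`. -/
def ColCand (t : ℕ) : Prop := numBelow t (fun t' => x.ColEq t' t) < x.q + x.k

/-- The index of a row in the list of candidates. -/
noncomputable def rowIdx (s : ℕ) : ℕ := numBelow s x.RowCand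

/-- The index of a column in the list of candidates. -/
noncomputable def colIdx (t : ℕ) : ℕ := numBelow t x.ColCand

/-- The column `t` is the guessed representative of the class `j`. -/
def ColRep (j t : ℕ) : Prop :=
  x.ColCand t ∧ x.colIdx t = digit ((x.q + x.k) ^ 2) j g.colReps

/-- The row `s` is the guessed representative of the class `i`. -/
def RowRep (i s : ℕ) : Prop :=
  x.RowCand s ∧ x.rowIdx s = digit ((x.p + x.k) ^ 2) i g.rowReps

/-- The representative of the class `j` is guessed to be wrong in the row `s`. -/
def Flip (j s : ℕ) : Prop :=
  ∃ e < x.delta,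
    x.RowCand s ∧ x.rowIdx s = digit ((x.p + x.k) ^ 2 + 1) (j * x.delta + e) g.flips

/-- The entry in the row `s` of the guessed pattern of the columns of the class `j`. -/
def Pat (j s : ℕ) : Prop := ¬ ((∃ t < x.n, x.ColRep g j t ∧ x.a s t = 1) ↔ x.Flip g j s)

/-- The distance of the column `t` from the guessed pattern of the class `j`. -/
noncomputable def patDist (t j : ℕ) : ℕ := numBelow x.m fun s => ¬ (x.a s t = 1 ↔ x.Pat g j s)

/-- The class `j` is guessed to have a column with at most `delta` errors. -/
def Good (j : ℕ) : Prop := digit 2 j g.good = 1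

/-- The column `t` has distance more than `delta` from all guessed patterns of good classes. -/
def Far (t : ℕ) : Prop := ∀ j < x.q, Good g j → x.delta < x.patDist g t j

/-- The column `t` is the guessed representative of some class. -/
def IsColRep (t : ℕ) : Prop := ∃ j < x.q, x.ColRep g j t

/-- The row `s` is the guessed representative of some class. -/
def IsRowRep (s : ℕ) : Prop := ∃ i < x.p, x.RowRep g i s

/-- `j` is a class for the column `t`: the right one if `t` is a representative, the one guessed if
`t` is far, and otherwise that of a nearest pattern of a good class. -/
def ColClass (t j : ℕ) : Prop :=
  (x.IsColRep g t ∧ x.ColRep g j t) ∨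
  (¬ x.IsColRep g t ∧
    ((x.Far g t ∧ j = digit x.q (numBelow t (x.Far g)) g.far) ∨
     (¬ x.Far g t ∧ Good g j ∧ ∀ j' < x.q, Good g j' → x.patDist g t j ≤ x.patDist g t j')))

/-- The class of the column `t` according to the guess. -/
noncomputable def tau (t : ℕ) : ℕ := least x.q (x.ColClass g t)

/-- The number of errors in the row `s` for the column classes `τ` and the row class `i`. -/
noncomputable def rowErr (τ : ℕ → ℕ) (s i : ℕ) : ℕ := numBelow x.n fun t => x.a s t ≠ x.b i (τ t)

/-- The number of errors in the row `s` for the guessed column classes and the row class `i`. -/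
noncomputable def rowCost (s i : ℕ) : ℕ := x.rowErr (x.tau g) s i

/-- `i` is a class for the row `s`: the right one if `s` is a representative, and otherwise one
with the fewest errors. -/
def RowClass (s i : ℕ) : Prop :=
  (x.IsRowRep g s ∧ x.RowRep g i s) ∨
  (¬ x.IsRowRep g s ∧ ∀ i' < x.p, x.rowCost g s i ≤ x.rowCost g s i')

/-- The class of the row `s` according to the guess. -/
noncomputable def sigma (s : ℕ) : ℕ := least x.p (x.RowClass g s)

/-- The guess leads to a solution. -/
def Accept : Prop :=
  ((∀ s < x.m, x.sigma g s < x.p) ∧ ∀ i < x.p, ∃ s < x.m, x.sigma g s = i) ∧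
  ((∀ t < x.n, x.tau g t < x.q) ∧ ∀ j < x.q, ∃ t < x.n, x.tau g t = j) ∧
  ∑ s ∈ Finset.range x.m, x.rowCost g s (x.sigma g s) ≤ x.k

/-- Some guess leads to a solution. -/
def Search : Prop :=
  ∃ c₁ < ((x.q + x.k) ^ 2) ^ x.q, ∃ c₂ < ((x.p + x.k) ^ 2 + 1) ^ (x.q * x.delta),
    ∃ c₃ < 2 ^ x.q, ∃ c₄ < x.q ^ x.farBound, ∃ c₅ < ((x.p + x.k) ^ 2) ^ x.p,
      x.Accept ⟨c₁, c₂, c₃, c₄, c₅⟩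

end Inst

section

open Inst

variable {Γ : Type} [Ctx Γ]

theorem PolyBdd.of_inst {f : Inst → ℕ} (c : ℕ) (h : ∀ x : Inst, f x ≤ x.size ^ c) :
    PolyBdd fun γ : Γ => f (Ctx.inst γ) :=
  ⟨c, fun γ => (h _).trans (Nat.pow_le_pow_left (by unfold csize; omega) c)⟩

theorem PolyBdd.of_budget {f : Inst → ℕ} (c : ℕ) (h : ∀ x : Inst, f x ≤ x.budget ^ c) :
    PolyBdd fun γ : Γ => f (Ctx.inst γ) :=
  .of_inst c fun x => (h x).trans (Nat.pow_le_pow_left x.budget_le_size c)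

theorem PT.m : PT fun γ : Γ => (Ctx.inst γ).m :=
  ⟨.of_inst 1 fun x => by simpa using x.m_le_size, .var 0, fun _ => rfl, .const 2⟩

theorem PT.n : PT fun γ : Γ => (Ctx.inst γ).n :=
  ⟨.of_inst 1 fun x => by simpa using x.n_le_size, .var 1, fun _ => rfl, .const 2⟩

theorem PT.p : PT fun γ : Γ => (Ctx.inst γ).p :=
  ⟨.of_budget 1 fun x => by simpa using x.p_le_budget, .var 2, fun _ => rfl, .const 2⟩

theorem PT.q : PT fun γ : Γ => (Ctx.inst γ).q :=
  ⟨.of_budget 1 fun x => by simpa using x.q_le_budget, .var 3, fun _ => rfl, .const 2⟩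

theorem PT.k : PT fun γ : Γ => (Ctx.inst γ).k :=
  ⟨.of_budget 1 fun x => by simpa using x.k_le_budget, .var 4, fun _ => rfl, .const 2⟩

theorem rowMajor_le_one {m n : ℕ} (A : Matrix (Fin m) (Fin n) Bool) (t : ℕ) :
    rowMajor A t ≤ 1 := by
  unfold rowMajor
  split_ifs
  · exact Bool.toNat_le _
  · exact zero_le_one

variable {f g h : Γ → ℕ} {G : Γ → Guess}

theorem PT.a (hf : PT f) (hg : PT g) : PT fun γ => (Ctx.inst γ).a (f γ) (g γ) := by
  obtain ⟨-, t, ht, hT⟩ := (hf.mul PT.n).add hg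
  exact ⟨(PolyBdd.const 1).mono fun _ => rowMajor_le_one _ _, .cell 0 t,
    fun γ => by rw [RAM.Tm.eval, ht]; rfl, hT.add (.const 3)⟩

theorem PT.b (hf : PT f) (hg : PT g) : PT fun γ => (Ctx.inst γ).b (f γ) (g γ) := by
  obtain ⟨-, t, ht, hT⟩ := (hf.mul PT.q).add hg
  exact ⟨(PolyBdd.const 1).mono fun _ => rowMajor_le_one _ _, .cell 1 t,
    fun γ => by rw [RAM.Tm.eval, ht]; rfl, hT.add (.const 3)⟩

theorem PT.sq (hf : PT f) : PT fun γ => f γ ^ 2 := (hf.mul hf).congr fun _ => (pow_two _).symm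

theorem PT.digit (hf : PT f) (hg : PT g) (hh : PT h) (hpos : ∀ γ, 1 ≤ f γ) :
    PT fun γ => digit (f γ) (g γ) (h γ) :=
  ((hh.div (PT.pow_min hf hg (hh.add (.const 1)) hpos)).mod hf).congr fun γ => by
    rcases le_total (f γ ^ g γ) (h γ + 1) with h1 | h1
    · rw [min_eq_left h1, PMatrixApproximation.digit]
    · rw [min_eq_right h1, PMatrixApproximation.digit, Nat.div_eq_of_lt (by omega),
        Nat.div_eq_of_lt (by omega)]

theorem PT.delta : PT fun γ : Γ => (Ctx.inst γ).delta := (PT.k.div (PT.p.add PT.k).log_two).sqrt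

theorem PT.farBound : PT fun γ : Γ => (Ctx.inst γ).farBound :=
  PT.k.div (PT.delta.add (.const 1))

theorem PD.rowEq (hf : PT f) (hg : PT g) : PD fun γ => (Ctx.inst γ).RowEq (f γ) (g γ) :=
  PD.all PT.n (PD.eq (PT.a hf.fst PT.snd) (PT.a hg.fst PT.snd))

theorem PD.colEq (hf : PT f) (hg : PT g) : PD fun γ => (Ctx.inst γ).ColEq (f γ) (g γ) :=
  PD.all PT.m (PD.eq (PT.a PT.snd hf.fst) (PT.a PT.snd hg.fst))

theorem PD.rowCand (hf : PT f) : PD fun γ => (Ctx.inst γ).RowCand (f γ) :=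
  PD.lt (PT.numBelow hf (PD.rowEq PT.snd hf.fst)) (PT.p.add PT.k)

theorem PD.colCand (hf : PT f) : PD fun γ => (Ctx.inst γ).ColCand (f γ) :=
  PD.lt (PT.numBelow hf (PD.colEq PT.snd hf.fst)) (PT.q.add PT.k)

theorem PT.rowIdx (hf : PT f) : PT fun γ => (Ctx.inst γ).rowIdx (f γ) :=
  PT.numBelow hf (PD.rowCand PT.snd)

theorem PT.colIdx (hf : PT f) : PT fun γ => (Ctx.inst γ).colIdx (f γ) :=
  PT.numBelow hf (PD.colCand PT.snd)

/-- The five numbers that make up the guess are computed in polynomial time. -/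
structure PTGuess (G : Γ → Guess) : Prop where
  colReps : PT fun γ => (G γ).colReps
  flips : PT fun γ => (G γ).flips
  good : PT fun γ => (G γ).good
  far : PT fun γ => (G γ).far
  rowReps : PT fun γ => (G γ).rowReps

theorem PTGuess.fst (hG : PTGuess G) : PTGuess fun y : Γ × ℕ => G y.1 :=
  ⟨hG.colReps.fst, hG.flips.fst, hG.good.fst, hG.far.fst, hG.rowReps.fst⟩

theorem Inst.one_le_p_add_sq (x : Inst) : 1 ≤ (x.p + x.k) ^ 2 :=
  Nat.one_le_pow _ _ (Nat.add_pos_left x.hp _)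

theorem Inst.one_le_q_add_sq (x : Inst) : 1 ≤ (x.q + x.k) ^ 2 :=
  Nat.one_le_pow _ _ (Nat.add_pos_left x.hq _)

theorem PD.colRep (hG : PTGuess G) (hf : PT f) (hg : PT g) :
    PD fun γ => (Ctx.inst γ).ColRep (G γ) (f γ) (g γ) :=
  (PD.colCand hg).and (PD.eq (PT.colIdx hg)
    (PT.digit (PT.q.add PT.k).sq hf hG.colReps fun _ => one_le_q_add_sq _))

theorem PD.rowRep (hG : PTGuess G) (hf : PT f) (hg : PT g) :
    PD fun γ => (Ctx.inst γ).RowRep (G γ) (f γ) (g γ) :=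
  (PD.rowCand hg).and (PD.eq (PT.rowIdx hg)
    (PT.digit (PT.p.add PT.k).sq hf hG.rowReps fun _ => one_le_p_add_sq _))

theorem PD.flip (hG : PTGuess G) (hf : PT f) (hg : PT g) :
    PD fun γ => (Ctx.inst γ).Flip (G γ) (f γ) (g γ) :=
  PD.ex PT.delta ((PD.rowCand hg.fst).and (PD.eq (PT.rowIdx hg.fst)
    (PT.digit ((PT.p.add PT.k).sq.add (.const 1)) ((hf.fst.mul PT.delta).add PT.snd) hG.fst.flips
      fun _ => Nat.le_add_left 1 _)))

theorem PD.pat (hG : PTGuess G) (hf : PT f) (hg : PT g) :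
    PD fun γ => (Ctx.inst γ).Pat (G γ) (f γ) (g γ) :=
  (PD.iff (PD.ex PT.n ((PD.colRep hG.fst hf.fst PT.snd).and
    (PD.eq (PT.a hg.fst PT.snd) (.const 1)))) (PD.flip hG hf hg)).not

theorem PT.patDist (hG : PTGuess G) (hf : PT f) (hg : PT g) :
    PT fun γ => (Ctx.inst γ).patDist (G γ) (f γ) (g γ) :=
  PT.numBelow PT.m (PD.iff (PD.eq (PT.a PT.snd hf.fst) (.const 1))
    (PD.pat hG.fst hg.fst PT.snd)).not

theorem PD.good (hG : PTGuess G) (hf : PT f) : PD fun γ => Good (G γ) (f γ) :=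
  PD.eq (PT.digit (.const 2) hf hG.good fun _ => one_le_two) (.const 1)

theorem PD.far (hG : PTGuess G) (hf : PT f) : PD fun γ => (Ctx.inst γ).Far (G γ) (f γ) :=
  PD.all PT.q ((PD.good hG.fst PT.snd).imp (PD.lt PT.delta (PT.patDist hG.fst hf.fst PT.snd)))

theorem PD.isColRep (hG : PTGuess G) (hf : PT f) :
    PD fun γ => (Ctx.inst γ).IsColRep (G γ) (f γ) :=
  PD.ex PT.q (PD.colRep hG.fst PT.snd hf.fst)

theorem PD.isRowRep (hG : PTGuess G) (hf : PT f) :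
    PD fun γ => (Ctx.inst γ).IsRowRep (G γ) (f γ) :=
  PD.ex PT.p (PD.rowRep hG.fst PT.snd hf.fst)

theorem PD.colClass (hG : PTGuess G) (hf : PT f) (hg : PT g) :
    PD fun γ => (Ctx.inst γ).ColClass (G γ) (f γ) (g γ) :=
  ((PD.isColRep hG hf).and (PD.colRep hG hg hf)).or ((PD.isColRep hG hf).not.and
    (((PD.far hG hf).and (PD.eq hg (PT.digit PT.q (PT.numBelow hf (PD.far hG.fst PT.snd)) hG.far
      fun _ => Inst.hq _))).or ((PD.far hG hf).not.and ((PD.good hG hg).and (PD.all PT.q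
        ((PD.good hG.fst PT.snd).imp (PD.le (PT.patDist hG.fst hf.fst hg.fst)
          (PT.patDist hG.fst hf.fst PT.snd))))))))

theorem PT.tau (hG : PTGuess G) (hf : PT f) : PT fun γ => (Ctx.inst γ).tau (G γ) (f γ) :=
  PT.least PT.q (PD.colClass hG.fst hf.fst PT.snd)

theorem PT.rowCost (hG : PTGuess G) (hf : PT f) (hg : PT g) :
    PT fun γ => (Ctx.inst γ).rowCost (G γ) (f γ) (g γ) :=
  PT.numBelow PT.n (PD.eq (PT.a hf.fst PT.snd) (PT.b hg.fst (PT.tau hG.fst PT.snd))).not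

theorem PD.rowClass (hG : PTGuess G) (hf : PT f) (hg : PT g) :
    PD fun γ => (Ctx.inst γ).RowClass (G γ) (f γ) (g γ) :=
  ((PD.isRowRep hG hf).and (PD.rowRep hG hg hf)).or ((PD.isRowRep hG hf).not.and
    (PD.all PT.p (PD.le (PT.rowCost hG.fst hf.fst hg.fst) (PT.rowCost hG.fst hf.fst PT.snd))))

theorem PT.sigma (hG : PTGuess G) (hf : PT f) : PT fun γ => (Ctx.inst γ).sigma (G γ) (f γ) :=
  PT.least PT.p (PD.rowClass hG.fst hf.fst PT.snd)

theorem PD.accept (hG : PTGuess G) : PD fun γ => (Ctx.inst γ).Accept (G γ) :=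
  PD.and (PD.and (PD.all PT.m (PD.lt (PT.sigma hG.fst PT.snd) PT.p))
    (PD.all PT.p (PD.ex PT.m (PD.eq (PT.sigma hG.fst.fst PT.snd) PT.snd.fst))))
  (PD.and (PD.and (PD.all PT.n (PD.lt (PT.tau hG.fst PT.snd) PT.q))
    (PD.all PT.q (PD.ex PT.n (PD.eq (PT.tau hG.fst.fst PT.snd) PT.snd.fst))))
  (PD.le (PT.sum PT.m (PT.rowCost hG.fst PT.snd (PT.sigma hG.fst PT.snd))) PT.k))

theorem PD.search : PD fun x : Inst => x.Search :=
  PD.ex (PT.pow (PT.q.add PT.k).sq PT.q (.of_budget 2 colReps_bound)) <|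
  PD.ex (PT.pow ((PT.p.add PT.k).sq.add (.const 1)) (PT.q.mul PT.delta)
    (.of_budget 6 flips_bound)) <|
  PD.ex (PT.pow (.const 2) PT.q (((PolyBdd.const 2).mul (.of_budget 1 fun _ => (pow_one _).ge)).mono
    fun _ => good_bound _)) <|
  PD.ex (PT.pow PT.q PT.farBound (.of_budget 1 fun x => x.far_bound.trans_eq (pow_one _).symm)) <|
  PD.ex (PT.pow (PT.p.add PT.k).sq PT.p (.of_budget 2 rowReps_bound)) <|
  PD.accept ⟨PT.snd.fst.fst.fst.fst, PT.snd.fst.fst.fst, PT.snd.fst.fst, PT.snd.fst, PT.snd⟩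

end

end PMatrixApproximation

/-! ### Counting -/

namespace PMatrixApproximation

theorem numBelow_eq_sum (b : ℕ) (φ : ℕ → Prop) [DecidablePred φ] :
    numBelow b φ = ∑ i ∈ Finset.range b, if φ i then 1 else 0 := by
  rw [numBelow_eq, Finset.card_filter]

theorem numBelow_congr {b : ℕ} {φ ψ : ℕ → Prop} (h : ∀ i < b, φ i ↔ ψ i) :
    numBelow b φ = numBelow b ψ := by
  classical
  rw [numBelow_eq, numBelow_eq, Finset.filter_congr fun i hi => h i (Finset.mem_range.1 hi)]

theorem numBelow_lt {φ : ℕ → Prop} {s s' : ℕ} (h : s < s') (hs : φ s) :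
    numBelow s φ < numBelow s' φ := by
  classical
  rw [numBelow_eq, numBelow_eq]
  refine Finset.card_lt_card ((Finset.ssubset_iff_of_subset (Finset.filter_subset_filter _
    (Finset.range_subset_range.2 h.le))).2 ⟨s, ?_, ?_⟩)
  · simp [h, hs]
  · simp

theorem numBelow_inj {φ : ℕ → Prop} {s s' : ℕ} (hs : φ s) (hs' : φ s')
    (h : numBelow s φ = numBelow s' φ) : s = s' := by
  rcases lt_trichotomy s s' with h' | h' | h'
  · exact absurd h (numBelow_lt h' hs).ne
  · exact h'
  · exact absurd h (numBelow_lt h' hs').ne'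

theorem sum_numBelow_comm (m n : ℕ) (φ : ℕ → ℕ → Prop) :
    ∑ s ∈ Finset.range m, numBelow n (φ s) =
      ∑ t ∈ Finset.range n, numBelow m fun s => φ s t := by
  classical
  simp_rw [numBelow_eq_sum]
  exact Finset.sum_comm

/-- Markov's inequality. -/
theorem numBelow_mul_le_sum (b d : ℕ) (f : ℕ → ℕ) :
    numBelow b (fun i => d < f i) * (d + 1) ≤ ∑ i ∈ Finset.range b, f i := by
  rw [numBelow_eq_sum, Finset.sum_mul]
  refine Finset.sum_le_sum fun i _ => ?_
  split_ifs <;> omega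

theorem numBelow_mono {b : ℕ} {φ ψ : ℕ → Prop} (h : ∀ i < b, φ i → ψ i) :
    numBelow b φ ≤ numBelow b ψ := by
  classical
  rw [numBelow_eq, numBelow_eq]
  refine Finset.card_le_card fun i => ?_
  simp only [Finset.mem_filter, Finset.mem_range]
  exact fun hi => ⟨hi.1, h i hi.1 hi.2⟩

theorem numBelow_pos_iff {b : ℕ} {φ : ℕ → Prop} : 0 < numBelow b φ ↔ ∃ i < b, φ i := by
  classical
  simp [numBelow_eq, Finset.card_pos, Finset.Nonempty]

/-- Every sequence of digits is that of a number. -/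
theorem exists_digits {R : ℕ} (len : ℕ) : ∀ f : ℕ → ℕ, (∀ i < len, f i < R) →
    ∃ c < R ^ len, ∀ i < len, digit R i c = f i := by
  induction len with
  | zero => exact fun f _ => ⟨0, by simp, by simp⟩
  | succ len ih =>
    intro f hf
    obtain ⟨c, hc, h⟩ := ih (fun i => f (i + 1)) fun i hi => hf (i + 1) (by omega)
    have h0 := hf 0 (by omega)
    have hdiv : (f 0 + R * c) / R = c := by
      rw [Nat.add_mul_div_left _ _ (by omega), Nat.div_eq_of_lt h0, zero_add]
    refine ⟨f 0 + R * c, ?_, fun i hi => ?_⟩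
    · rw [pow_succ']
      nlinarith
    · cases i with
      | zero => simp [digit, Nat.add_mul_mod_self_left, Nat.mod_eq_of_lt h0]
      | succ i =>
        rw [← h i (by omega), digit, digit, pow_succ', ← Nat.div_div_eq_div_mul, hdiv]

/-- A set of at most `M` numbers can be permuted within the classes of `E` so that in each class
it goes into the first `M` elements. -/
theorem exists_perm_rank_lt {E : ℕ → ℕ → Prop} (hE : Equivalence E) {m M : ℕ} :
    ∀ (w : ℕ) (S : Finset ℕ), ∑ s ∈ S, s = w → S ⊆ Finset.range m → S.card ≤ M →
      ∃ π : Equiv.Perm ℕ, (∀ s, π s < m ↔ s < m) ∧ (∀ s, E (π s) s) ∧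
        ∀ s ∈ S, numBelow (π s) (fun s' => E s' (π s)) < M := by
  classical
  intro w
  induction w using Nat.strong_induction_on with
  | _ w ih =>
    intro S hw hS hM
    by_cases hgood : ∀ s ∈ S, numBelow s (fun s' => E s' s) < M
    · exact ⟨1, fun s => Iff.rfl, fun s => hE.refl s, hgood⟩
    push Not at hgood
    obtain ⟨s, hs, hsM⟩ := hgood
    -- some element of the class that precedes `s` is not in `S`: exchange it with `s`
    obtain ⟨u, hu, huS⟩ : ∃ u ∈ (Finset.range s).filter fun s' => E s' s, u ∉ S.erase s := by
      by_contra! hsub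
      have h1 := Finset.card_le_card hsub
      rw [← numBelow_eq, Finset.card_erase_of_mem hs] at h1
      have := Finset.card_pos.2 ⟨s, hs⟩
      omega
    simp only [Finset.mem_filter, Finset.mem_range] at hu
    have hsm := Finset.mem_range.1 (hS hs)
    obtain ⟨π, h1, h2, h3⟩ := ih (∑ v ∈ insert u (S.erase s), v) (by
        rw [Finset.sum_insert huS, ← hw, ← Finset.add_sum_erase S _ hs]
        omega) (insert u (S.erase s)) rfl
      (by
        intro v hv
        rw [Finset.mem_insert] at hv
        rcases hv with rfl | hv
        · exact Finset.mem_range.2 (hu.1.trans hsm)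
        · exact hS (Finset.mem_of_mem_erase hv))
      (by
        rw [Finset.card_insert_of_notMem huS, Finset.card_erase_of_mem hs]
        have := Finset.card_pos.2 ⟨s, hs⟩
        omega)
    have hne : u ≠ s := hu.1.ne
    have huS' : u ∉ S := fun h => huS (Finset.mem_erase.2 ⟨hne, h⟩)
    refine ⟨π * Equiv.swap s u, fun v => ?_, fun v => ?_, fun v hv => ?_⟩
    · rw [Equiv.Perm.mul_apply, h1, Equiv.swap_apply_def]
      split_ifs <;> omega
    · refine hE.trans (h2 _) ?_
      rw [Equiv.swap_apply_def]
      split_ifs with h h'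
      · rw [h]; exact hu.2
      · rw [h']; exact hE.symm hu.2
      · exact hE.refl v
    · refine h3 _ ?_
      rw [Equiv.swap_apply_def, Finset.mem_insert, Finset.mem_erase]
      split_ifs with h h'
      · exact Or.inl rfl
      · exact absurd (h' ▸ hv) huS'
      · exact Or.inr ⟨h, hv⟩

/-- If `E` has at most `#T` classes below `m`, then at most `#T * M` numbers are among the first
`M` of their class. -/
theorem numBelow_rank_lt_le {E : ℕ → ℕ → Prop} (hE : Equivalence E) {m M : ℕ} (f : ℕ → ℕ)
    (T : Finset ℕ) (hf : ∀ s < m, f s ∈ T) (h : ∀ s < m, ∀ s' < m, f s = f s' → E s s') :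
    numBelow m (fun s => numBelow s (fun s' => E s' s) < M) ≤ T.card * M := by
  classical
  rw [numBelow_eq, mul_comm]
  refine Finset.card_le_mul_card_image_of_maps_to (f := f)
    (fun s hs => hf s (Finset.mem_range.1 (Finset.mem_filter.1 hs).1)) M fun y _ => ?_
  refine (Finset.card_le_card_of_injOn (t := Finset.range M)
    (fun s => numBelow s (fun s' => E s' s)) (fun s hs => ?_) fun s hs s' hs' he => ?_).trans_eq
      (Finset.card_range M)
  · simp only [Finset.coe_filter, Finset.mem_filter, Finset.mem_range, Set.mem_ofPred_eq] at hs
    simpa using hs.1.2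
  · simp only [Finset.coe_filter, Finset.mem_filter, Finset.mem_range, Set.mem_ofPred_eq] at hs hs'
    have hss' := h s hs.1.1 s' hs'.1.1 (hs.2.trans hs'.2.symm)
    dsimp only at he
    rw [numBelow_congr fun i _ => ⟨fun hi => hE.trans hi hss',
      fun hi => hE.trans hi (hE.symm hss')⟩] at he
    exact numBelow_inj (φ := fun i => E i s') hss' (hE.refl s') he

/-- If all but `k` numbers below `m` fall into `p` classes of `E`, then at most `(p + k) ^ 2`
numbers below `m` are among the first `p + k` of their class. -/
theorem numBelow_cand_le {E : ℕ → ℕ → Prop} (hE : Equivalence E) {m p k : ℕ} {σ : ℕ → ℕ}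
    {φ : ℕ → Prop} (hσ : ∀ s < m, σ s < p) (hφ : numBelow m φ ≤ k)
    (h : ∀ s < m, ∀ s' < m, ¬ φ s → ¬ φ s' → σ s = σ s' → E s s') :
    numBelow m (fun s => numBelow s (fun s' => E s' s) < p + k) ≤ (p + k) ^ 2 := by
  classical
  refine (numBelow_rank_lt_le hE (fun s => if φ s then p + s else σ s)
    (Finset.range p ∪ ((Finset.range m).filter φ).image (p + ·)) (fun s hs => ?_)
    fun s hs s' hs' he => ?_).trans ?_
  · split_ifs with h'
    · exact Finset.mem_union_right _ (Finset.mem_image_of_mem _ (by simp [hs, h']))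
    · exact Finset.mem_union_left _ (Finset.mem_range.2 (hσ s hs))
  · have h1 := hσ s hs
    have h2 := hσ s' hs'
    split_ifs at he with h3 h4 h4
    · rw [Nat.add_left_cancel he]; exact hE.refl _
    · omega
    · omega
    · exact h s hs s' hs' h3 h4 he
  · rw [pow_two]
    refine Nat.mul_le_mul_right _ ((Finset.card_union_le _ _).trans ?_)
    rw [Finset.card_range]
    rw [numBelow_eq] at hφ
    exact Nat.add_le_add_left (Finset.card_image_le.trans hφ) _

end PMatrixApproximation

/-! ### Correctness -/

namespace PMatrixApproximation

/-- `f` maps the numbers below `m` onto the numbers below `p`. -/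
def Onto (m p : ℕ) (f : ℕ → ℕ) : Prop :=
  (∀ s < m, f s < p) ∧ ∀ i < p, ∃ s < m, f s = i

theorem sum_range_perm {m : ℕ} (π : Equiv.Perm ℕ) (hπ : ∀ s, π s < m ↔ s < m) (f : ℕ → ℕ) :
    ∑ s ∈ Finset.range m, f (π s) = ∑ s ∈ Finset.range m, f s :=
  Finset.sum_equiv π (by simp [hπ]) fun _ _ => rfl

theorem Onto.perm {m p : ℕ} {f : ℕ → ℕ} (h : Onto m p f)
    (π : Equiv.Perm ℕ) (hπ : ∀ s, π s < m ↔ s < m) : Onto m p fun s => f (π.symm s) := by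
  refine ⟨fun s hs => h.1 _ ?_, fun i hi => ?_⟩
  · rwa [← hπ, Equiv.apply_symm_apply]
  · obtain ⟨s, hs, rfl⟩ := h.2 i hi
    exact ⟨π s, (hπ s).2 hs, by simp⟩

theorem numBelow_perm {m : ℕ} (π : Equiv.Perm ℕ)
    (hπ : ∀ s, π s < m ↔ s < m) (φ : ℕ → Prop) : numBelow m (fun s => φ (π s)) = numBelow m φ := by
  classical
  rw [numBelow_eq_sum, numBelow_eq_sum, ← sum_range_perm π hπ fun s => if φ s then 1 else 0]

theorem numBelow_eq_digit_iff {C : ℕ → Prop} {R j t : ℕ} {r : ℕ → ℕ} {c : ℕ} (hr : C (r j))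
    (hc : digit R j c = numBelow (r j) C) :
    (C t ∧ numBelow t C = digit R j c) ↔ t = r j := by
  rw [hc]
  refine ⟨fun h => numBelow_inj h.1 hr h.2, ?_⟩
  rintro rfl
  exact ⟨hr, rfl⟩

theorem rowMajor_apply {m n : ℕ} (A : Matrix (Fin m) (Fin n) Bool)
    (s : Fin m) (t : Fin n) : rowMajor A (s * n + t) = (A s t).toNat := by
  have h1 : ((s : ℕ) * n + t) / n = s := by
    rw [mul_comm, Nat.mul_add_div t.pos, Nat.div_eq_of_lt t.2, add_zero]
  have h2 : ((s : ℕ) * n + t) % n = t := by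
    rw [mul_comm, Nat.mul_add_mod, Nat.mod_eq_of_lt t.2]
  simp only [rowMajor, h1, h2]
  rw [dif_pos ⟨s.2, t.2⟩]

theorem toNat_sub_sq (u v : Bool) :
    ((u.toNat : ℝ) - (v.toNat : ℝ)) ^ 2 = ((if u.toNat ≠ v.toNat then 1 else 0 : ℕ) : ℝ) := by
  cases u <;> cases v <;> simp

namespace Inst

variable (x : Inst)

/-- The number of errors in the column `t` for the row classes `σ` and the column class `j`. -/
noncomputable def colErr (σ : ℕ → ℕ) (t j : ℕ) : ℕ := numBelow x.m fun s => x.a s t ≠ x.b (σ s) j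

/-- The classes `σ` of the rows and `τ` of the columns make up a solution. -/
def IsSol (σ τ : ℕ → ℕ) : Prop :=
  Onto x.m x.p σ ∧ Onto x.n x.q τ ∧ ∑ s ∈ Finset.range x.m, x.rowErr τ s (σ s) ≤ x.k

theorem sum_rowErr (σ τ : ℕ → ℕ) :
    ∑ s ∈ Finset.range x.m, x.rowErr τ s (σ s) = ∑ t ∈ Finset.range x.n, x.colErr σ t (τ t) :=
  sum_numBelow_comm _ _ _

theorem rowEq_equivalence : Equivalence x.RowEq :=
  ⟨fun _ _ _ => rfl, fun h t ht => (h t ht).symm, fun h h' t ht => (h t ht).trans (h' t ht)⟩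

theorem colEq_equivalence : Equivalence x.ColEq :=
  ⟨fun _ _ _ => rfl, fun h t ht => (h t ht).symm, fun h h' t ht => (h t ht).trans (h' t ht)⟩

theorem numBelow_rowErr_le {σ τ : ℕ → ℕ} (h : x.IsSol σ τ) :
    numBelow x.m (fun s => 0 < x.rowErr τ s (σ s)) ≤ x.k := by
  simpa using (numBelow_mul_le_sum x.m 0 fun s => x.rowErr τ s (σ s)).trans h.2.2

theorem numBelow_colErr_le {σ τ : ℕ → ℕ} (h : x.IsSol σ τ) :
    numBelow x.n (fun t => 0 < x.colErr σ t (τ t)) ≤ x.k := by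
  have := (numBelow_mul_le_sum x.n 0 fun t => x.colErr σ t (τ t)).trans
    ((x.sum_rowErr σ τ).symm.trans_le h.2.2)
  simpa using this

theorem numBelow_rowCand_le {σ τ : ℕ → ℕ} (h : x.IsSol σ τ) :
    numBelow x.m x.RowCand ≤ (x.p + x.k) ^ 2 := by
  refine numBelow_cand_le x.rowEq_equivalence h.1.1 (x.numBelow_rowErr_le h)
    fun s _ s' _ hs hs' he t ht => ?_
  simp only [rowErr, numBelow_pos_iff, not_exists, not_and, not_not] at hs hs'
  rw [hs t ht, hs' t ht, he]

theorem numBelow_colCand_le {σ τ : ℕ → ℕ} (h : x.IsSol σ τ) :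
    numBelow x.n x.ColCand ≤ (x.q + x.k) ^ 2 := by
  refine numBelow_cand_le x.colEq_equivalence h.2.1.1 (x.numBelow_colErr_le h)
    fun s _ s' _ hs hs' he t ht => ?_
  simp only [colErr, numBelow_pos_iff, not_exists, not_and, not_not] at hs hs'
  rw [hs t ht, hs' t ht, he]

/-- Equal rows can be exchanged so that all rows with errors, and a representative of each class,
are candidates. -/
theorem exists_rowCand {σ τ : ℕ → ℕ} (h : x.IsSol σ τ) :
    ∃ σ' ρ : ℕ → ℕ, x.IsSol σ' τ ∧ (∀ i < x.p, ρ i < x.m ∧ σ' (ρ i) = i ∧ x.RowCand (ρ i)) ∧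
      ∀ s < x.m, 0 < x.rowErr τ s (σ' s) → x.RowCand s := by
  classical
  choose! ρ hρ hσρ using h.1.2
  obtain ⟨π, h1, h2, h3⟩ := exists_perm_rank_lt x.rowEq_equivalence (m := x.m) (M := x.p + x.k) _
    ((Finset.range x.p).image ρ ∪ (Finset.range x.m).filter fun s => 0 < x.rowErr τ s (σ s)) rfl
    (by
      intro s
      simp only [Finset.mem_union, Finset.mem_image, Finset.mem_range, Finset.mem_filter]
      rintro (⟨i, hi, rfl⟩ | hs)
      · exact hρ i hi
      · exact hs.1)
    (by
      refine (Finset.card_union_le _ _).trans (Nat.add_le_add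
        (Finset.card_image_le.trans_eq (Finset.card_range _)) ?_)
      rw [← numBelow_eq]
      exact x.numBelow_rowErr_le h)
  have herr (s i : ℕ) : x.rowErr τ (π s) i = x.rowErr τ s i :=
    numBelow_congr fun t ht => by rw [h2 s t ht]
  refine ⟨fun s => σ (π.symm s), fun i => π (ρ i), ⟨h.1.perm π h1, h.2.1, ?_⟩, fun i hi => ?_,
    fun s hs hpos => ?_⟩
  · rw [← sum_range_perm π h1]
    simpa [herr] using h.2.2
  · refine ⟨(h1 _).2 (hρ i hi), by simp [hσρ i hi], h3 _ ?_⟩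
    exact Finset.mem_union_left _ (Finset.mem_image_of_mem _ (Finset.mem_range.2 hi))
  · obtain ⟨u, rfl⟩ := π.surjective s
    simp only [herr, Equiv.symm_apply_apply] at hpos
    exact h3 _ (Finset.mem_union_right _
      (Finset.mem_filter.2 ⟨Finset.mem_range.2 ((h1 u).1 hs), hpos⟩))

/-- Equal columns can be exchanged so that for each class, some column with the fewest errors is a
candidate. -/
theorem exists_colCand {σ τ : ℕ → ℕ} (h : x.IsSol σ τ)
    (hσ : ∀ s < x.m, 0 < x.rowErr τ s (σ s) → x.RowCand s) :
    ∃ τ' r : ℕ → ℕ, x.IsSol σ τ' ∧ (∀ j < x.q, r j < x.n ∧ τ' (r j) = j ∧ x.ColCand (r j)) ∧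
      (∀ t < x.n, x.colErr σ (r (τ' t)) (τ' t) ≤ x.colErr σ t (τ' t)) ∧
      ∀ s < x.m, 0 < x.rowErr τ' s (σ s) → x.RowCand s := by
  classical
  have hmin (j : ℕ) (hj : j < x.q) : ∃ t < x.n, τ t = j ∧
      ∀ t' < x.n, τ t' = j → x.colErr σ t j ≤ x.colErr σ t' j := by
    obtain ⟨t₀, ht₀, hτ⟩ := h.2.1.2 j hj
    obtain ⟨t, ht, hle⟩ := Finset.exists_min_image ((Finset.range x.n).filter fun t => τ t = j)
      (fun t => x.colErr σ t j) ⟨t₀, by simp [ht₀, hτ]⟩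
    simp only [Finset.mem_filter, Finset.mem_range] at ht hle
    exact ⟨t, ht.1, ht.2, fun t' h₁ h₂ => hle t' ⟨h₁, h₂⟩⟩
  choose! r hr hτr hrmin using hmin
  obtain ⟨π, h1, h2, h3⟩ := exists_perm_rank_lt x.colEq_equivalence (m := x.n) (M := x.q + x.k) _
    ((Finset.range x.q).image r) rfl
    (by
      intro s
      simp only [Finset.mem_image, Finset.mem_range]
      rintro ⟨i, hi, rfl⟩
      exact hr i hi)
    ((Finset.card_image_le.trans_eq (Finset.card_range _)).trans (Nat.le_add_right _ _))
  have hcol (t j : ℕ) : x.colErr σ (π t) j = x.colErr σ t j :=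
    numBelow_congr fun s hs => by rw [h2 t s hs]
  have hrow (s i : ℕ) (hs : s < x.m) : x.rowErr (fun t => τ (π.symm t)) s i = x.rowErr τ s i := by
    rw [rowErr, rowErr, ← numBelow_perm π h1]
    exact numBelow_congr fun t _ => by rw [h2 t s hs, Equiv.symm_apply_apply]
  refine ⟨fun t => τ (π.symm t), fun j => π (r j), ⟨h.1, h.2.1.perm π h1, ?_⟩, fun j hj => ?_,
    fun t ht => ?_, fun s hs hpos => ?_⟩
  · rw [Finset.sum_congr rfl fun s hs => hrow s _ (Finset.mem_range.1 hs)]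
    exact h.2.2
  · refine ⟨(h1 _).2 (hr j hj), by simp [hτr j hj], h3 _ ?_⟩
    exact Finset.mem_image_of_mem _ (Finset.mem_range.2 hj)
  · obtain ⟨u, rfl⟩ := π.surjective t
    have hu := (h1 u).1 ht
    simp only [hcol, Equiv.symm_apply_apply]
    exact hrmin _ (h.2.1.1 u hu) u hu rfl
  · rw [hrow s _ hs] at hpos
    exact hσ s hs hpos

variable {x}

theorem accept_isSol {g : Guess} (h : x.Accept g) : x.IsSol (x.sigma g) (x.tau g) := h

theorem a_le_one (s t : ℕ) : x.a s t ≤ 1 := rowMajor_le_one _ _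

theorem b_le_one (i j : ℕ) : x.b i j ≤ 1 := rowMajor_le_one _ _

/-- The rows in which the representative of each class is wrong can be guessed. -/
theorem exists_flips (D : ℕ → Finset ℕ) (hD : ∀ j, ∀ s ∈ D j, s < x.m ∧ x.RowCand s)
    (hcand : numBelow x.m x.RowCand ≤ (x.p + x.k) ^ 2) :
    ∃ c < ((x.p + x.k) ^ 2 + 1) ^ (x.q * x.delta), ∀ g : Guess, g.flips = c →
      ∀ j < x.q, (D j).card ≤ x.delta → ∀ s < x.m, x.Flip g j s ↔ s ∈ D j := by
  have hidx {s : ℕ} (hs : s < x.m) (hsc : x.RowCand s) : x.rowIdx s < (x.p + x.k) ^ 2 :=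
    (numBelow_lt hs hsc).trans_le hcand
  -- the digit `(p + k) ^ 2`, which is not the index of a row, fills the unused places
  obtain ⟨c, hc, h⟩ := exists_digits (R := (x.p + x.k) ^ 2 + 1) (x.q * x.delta)
    (fun i => (((D (i / x.delta)).toList)[i % x.delta]?).elim ((x.p + x.k) ^ 2) x.rowIdx) (by
      intro i _
      cases he : ((D (i / x.delta)).toList)[i % x.delta]? with
      | none => simp
      | some s =>
        have := hD _ s (Finset.mem_toList.1 (List.mem_of_getElem? he))
        exact (hidx this.1 this.2).trans (Nat.lt_succ_self _))
  refine ⟨c, hc, ?_⟩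
  rintro g rfl j hj hcard s hs
  have hdig {e : ℕ} (he : e < x.delta) :
      digit ((x.p + x.k) ^ 2 + 1) (j * x.delta + e) g.flips =
        ((D j).toList[e]?).elim ((x.p + x.k) ^ 2) x.rowIdx := by
    rw [h _ (by nlinarith), mul_comm, Nat.mul_add_div (by omega), Nat.div_eq_of_lt he,
      Nat.mul_add_mod, Nat.mod_eq_of_lt he, add_zero]
  constructor
  · rintro ⟨e, he, hsc, hse⟩
    rw [hdig he] at hse
    cases hl : (D j).toList[e]? with
    | none =>
      rw [hl] at hse
      exact absurd hse (hidx hs hsc).ne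
    | some u =>
      have hu := Finset.mem_toList.1 (List.mem_of_getElem? hl)
      rw [hl] at hse
      rwa [numBelow_inj hsc (hD j u hu).2 hse]
  · intro hsD
    obtain ⟨e, he⟩ := List.mem_iff_getElem?.1 (Finset.mem_toList.2 hsD)
    have hel : e < x.delta := by
      have := (List.getElem?_eq_some_iff.1 he).1
      rw [Finset.length_toList] at this
      omega
    exact ⟨e, hel, (hD j s hsD).2, by rw [hdig hel, he]; rfl⟩

/-- A solution is found: the representatives and the patterns of the good classes are guessed
right, and moving a near column that is not a representative to a nearest good class does not
increase the number of its errors. -/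
theorem search_of_isSol {σ τ : ℕ → ℕ} (h : x.IsSol σ τ) : x.Search := by
  classical
  obtain ⟨σ, ρ, h, hρ, hσ⟩ := x.exists_rowCand h
  obtain ⟨τ, r, h, hr, hmin, hσ⟩ := x.exists_colCand h hσ
  have hcolCand := x.numBelow_colCand_le h
  have hrowCand := x.numBelow_rowCand_le h
  -- the guess
  obtain ⟨c₁, hc₁, hd₁⟩ := exists_digits (R := (x.q + x.k) ^ 2) x.q (fun j => x.colIdx (r j))
    fun j hj => (numBelow_lt (hr j hj).1 (hr j hj).2.2).trans_le hcolCand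
  obtain ⟨c₂, hc₂, hd₂⟩ := exists_flips
    (fun j => (Finset.range x.m).filter fun s => x.RowCand s ∧ x.a s (r j) ≠ x.b (σ s) j)
    (fun j s hs => by simp only [Finset.mem_filter, Finset.mem_range] at hs; exact ⟨hs.1, hs.2.1⟩)
    hrowCand
  obtain ⟨c₃, hc₃, hd₃⟩ := exists_digits (R := 2) x.q
    (fun j => if x.colErr σ (r j) j ≤ x.delta then 1 else 0)
    fun j _ => by split_ifs <;> omega
  let Far' : ℕ → Prop := fun t =>
    ∀ j < x.q, x.colErr σ (r j) j ≤ x.delta → x.delta < x.colErr σ t j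
  obtain ⟨c₄, hc₄, hd₄⟩ := exists_digits (R := x.q) x.farBound
    (fun i => if h : ∃ t < x.n, Far' t ∧ numBelow t Far' = i then τ h.choose else 0) (by
      intro i _
      split_ifs with h'
      · exact h.2.1.1 _ h'.choose_spec.1
      · exact x.hq)
  obtain ⟨c₅, hc₅, hd₅⟩ := exists_digits (R := (x.p + x.k) ^ 2) x.p (fun i => x.rowIdx (ρ i))
    fun i hi => (numBelow_lt (hρ i hi).1 (hρ i hi).2.2).trans_le hrowCand
  refine ⟨c₁, hc₁, c₂, hc₂, c₃, hc₃, c₄, hc₄, c₅, hc₅, ?_⟩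
  set g : Guess := ⟨c₁, c₂, c₃, c₄, c₅⟩ with hg
  -- what is guessed right
  have hColRep {j t : ℕ} (hj : j < x.q) : x.ColRep g j t ↔ t = r j :=
    numBelow_eq_digit_iff (hr j hj).2.2 (hd₁ j hj)
  have hRowRep {i s : ℕ} (hi : i < x.p) : x.RowRep g i s ↔ s = ρ i :=
    numBelow_eq_digit_iff (hρ i hi).2.2 (hd₅ i hi)
  have hGood {j : ℕ} (hj : j < x.q) : Good g j ↔ x.colErr σ (r j) j ≤ x.delta := by
    rw [Good, hd₃ j hj]
    split_ifs with h' <;> simp [h']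
  have hFlip {j s : ℕ} (hj : j < x.q) (hjg : Good g j) (hs : s < x.m) :
      x.Flip g j s ↔ x.a s (r j) ≠ x.b (σ s) j := by
    rw [hd₂ g rfl j hj ?_ s hs]
    · simp only [Finset.mem_filter, Finset.mem_range]
      refine ⟨fun h' => h'.2.2, fun h' => ⟨hs, hσ s hs ?_, h'⟩⟩
      exact numBelow_pos_iff.2 ⟨r j, (hr j hj).1, by rwa [(hr j hj).2.1]⟩
    · rw [← numBelow_eq]
      exact (numBelow_mono fun s _ h' => h'.2).trans ((hGood hj).1 hjg)
  have hPat {j s : ℕ} (hj : j < x.q) (hjg : Good g j) (hs : s < x.m) :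
      x.Pat g j s ↔ x.b (σ s) j = 1 := by
    have h1 : (∃ t < x.n, x.ColRep g j t ∧ x.a s t = 1) ↔ x.a s (r j) = 1 := by
      simp only [hColRep hj]
      exact ⟨fun ⟨t, _, ht, h'⟩ => ht ▸ h', fun h' => ⟨r j, (hr j hj).1, rfl, h'⟩⟩
    rw [Pat, h1, hFlip hj hjg hs]
    have := x.a_le_one s (r j)
    have := x.b_le_one (σ s) j
    omega
  have hDist {j : ℕ} (t : ℕ) (hj : j < x.q) (hjg : Good g j) :
      x.patDist g t j = x.colErr σ t j := by
    refine numBelow_congr fun s hs => ?_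
    rw [hPat hj hjg hs]
    have := x.a_le_one s t
    have := x.b_le_one (σ s) j
    omega
  have hFar (t : ℕ) : x.Far g t ↔ Far' t := by
    refine forall₂_congr fun j hj => ?_
    rw [hGood hj]
    exact forall_congr' fun h' => by rw [hDist t hj ((hGood hj).2 h')]
  -- far columns have many errors, hence are few
  have hFarErr (t : ℕ) (ht : t < x.n) (hf : Far' t) : x.delta < x.colErr σ t (τ t) := by
    by_cases h' : x.colErr σ (r (τ t)) (τ t) ≤ x.delta
    · exact hf _ (h.2.1.1 t ht) h'
    · exact (not_le.1 h').trans_le (hmin t ht)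
  have hFarIdx (t : ℕ) (ht : t < x.n) (hf : Far' t) : numBelow t Far' < x.farBound := by
    refine (numBelow_lt ht hf).trans_le ((Nat.le_div_iff_mul_le (Nat.succ_pos _)).2 ?_)
    refine (Nat.mul_le_mul_right _ (numBelow_mono hFarErr)).trans
      ((numBelow_mul_le_sum x.n x.delta fun t => x.colErr σ t (τ t)).trans ?_)
    rw [← x.sum_rowErr]
    exact h.2.2
  have hFarDigit (t : ℕ) (ht : t < x.n) (hf : Far' t) :
      digit x.q (numBelow t (x.Far g)) g.far = τ t := by
    have h1 : numBelow t (x.Far g) = numBelow t Far' := numBelow_congr fun i _ => hFar i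
    have h2 : ∃ t' < x.n, Far' t' ∧ numBelow t' Far' = numBelow t Far' := ⟨t, ht, hf, rfl⟩
    rw [h1, hd₄ _ (hFarIdx t ht hf), dif_pos h2]
    obtain ⟨-, h3, h4⟩ := h2.choose_spec
    rw [numBelow_inj h3 hf h4]
  -- the classes of the columns
  have hTau (t : ℕ) (ht : t < x.n) :
      x.tau g t < x.q ∧ x.colErr σ t (x.tau g t) ≤ x.colErr σ t (τ t) ∧
        (x.IsColRep g t → x.tau g t = τ t) := by
    by_cases h1 : x.IsColRep g t
    · obtain ⟨j, hj, hjt⟩ := h1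
      obtain ⟨h2, h3⟩ := least_spec (b := x.q) (φ := x.ColClass g t)
        ⟨j, hj, Or.inl ⟨⟨j, hj, hjt⟩, hjt⟩⟩
      have h4 : x.tau g t = τ t := by
        rcases h3 with h3 | h3
        · have h5 := (hColRep h2).1 h3.2
          have h6 := (hr _ h2).2.1
          rw [← h5] at h6
          exact h6.symm
        · exact absurd ⟨j, hj, hjt⟩ h3.1
      exact ⟨h2, by rw [h4], fun _ => h4⟩
    by_cases h2 : x.Far g t
    · have h3 := hFarDigit t ht ((hFar t).1 h2)
      obtain ⟨h4, h5⟩ := least_spec (b := x.q) (φ := x.ColClass g t)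
        ⟨τ t, h.2.1.1 t ht, Or.inr ⟨h1, Or.inl ⟨h2, h3.symm⟩⟩⟩
      have h6 : x.tau g t = τ t := by
        rcases h5 with h5 | ⟨-, h5 | h5⟩
        · exact absurd h5.1 h1
        · exact h5.2.trans h3
        · exact absurd h2 h5.1
      exact ⟨h4, by rw [h6], fun _ => h6⟩
    · obtain ⟨j, hj, hjg, hjd⟩ : ∃ j < x.q, Good g j ∧ x.patDist g t j ≤ x.delta := by
        simpa [Far] using h2
      obtain ⟨j', hj', hle⟩ := Finset.exists_min_image
        ((Finset.range x.q).filter (Good g)) (fun j => x.patDist g t j) ⟨j, by simp [hj, hjg]⟩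
      simp only [Finset.mem_filter, Finset.mem_range] at hj' hle
      obtain ⟨h4, h5⟩ := least_spec (b := x.q) (φ := x.ColClass g t)
        ⟨j', hj'.1, Or.inr ⟨h1, Or.inr ⟨h2, hj'.2, fun i hi hig => hle i ⟨hi, hig⟩⟩⟩⟩
      refine ⟨h4, ?_, fun h' => absurd h' h1⟩
      rcases h5 with h5 | ⟨-, h5 | ⟨-, h5, h6⟩⟩
      · exact absurd h5.1 h1
      · exact absurd h5.1 h2
      · change Good g (x.tau g t) at h5
        change x.tau g t < x.q at h4
        rw [← hDist t h4 h5]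
        by_cases h7 : Good g (τ t)
        · rw [← hDist t (h.2.1.1 t ht) h7]
          exact h6 _ (h.2.1.1 t ht) h7
        · rw [hGood (h.2.1.1 t ht)] at h7
          have := hmin t ht
          have := h6 j hj hjg
          change x.patDist g t (x.tau g t) ≤ _ at this
          omega
  -- the classes of the rows
  have hSigma (s : ℕ) (hs : s < x.m) :
      x.sigma g s < x.p ∧ x.rowCost g s (x.sigma g s) ≤ x.rowCost g s (σ s) ∧
        (x.IsRowRep g s → x.sigma g s = σ s) := by
    by_cases h1 : x.IsRowRep g s
    · obtain ⟨i, hi, his⟩ := h1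
      obtain ⟨h2, h3⟩ := least_spec (b := x.p) (φ := x.RowClass g s)
        ⟨i, hi, Or.inl ⟨⟨i, hi, his⟩, his⟩⟩
      have h4 : x.sigma g s = σ s := by
        rcases h3 with h3 | h3
        · have h5 := (hRowRep h2).1 h3.2
          have h6 := (hρ _ h2).2.1
          rw [← h5] at h6
          exact h6.symm
        · exact absurd ⟨i, hi, his⟩ h3.1
      exact ⟨h2, by rw [h4], fun _ => h4⟩
    · obtain ⟨i, hi, hle⟩ := Finset.exists_min_image (Finset.range x.p) (x.rowCost g s)
        ⟨0, Finset.mem_range.2 x.hp⟩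
      simp only [Finset.mem_range] at hi hle
      obtain ⟨h4, h5⟩ := least_spec (b := x.p) (φ := x.RowClass g s)
        ⟨i, hi, Or.inr ⟨h1, hle⟩⟩
      refine ⟨h4, ?_, fun h' => absurd h' h1⟩
      rcases h5 with h5 | h5
      · exact absurd h5.1 h1
      · exact h5.2 _ (h.1.1 s hs)
  refine ⟨⟨fun s hs => (hSigma s hs).1, fun i hi => ⟨ρ i, (hρ i hi).1, ?_⟩⟩,
    ⟨fun t ht => (hTau t ht).1, fun j hj => ⟨r j, (hr j hj).1, ?_⟩⟩, ?_⟩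
  · rw [(hSigma _ (hρ i hi).1).2.2 ⟨i, hi, (hRowRep hi).2 rfl⟩, (hρ i hi).2.1]
  · rw [(hTau _ (hr j hj).1).2.2 ⟨j, hj, (hColRep hj).2 rfl⟩, (hr j hj).2.1]
  · calc ∑ s ∈ Finset.range x.m, x.rowCost g s (x.sigma g s)
        ≤ ∑ s ∈ Finset.range x.m, x.rowErr (x.tau g) s (σ s) :=
          Finset.sum_le_sum fun s hs => (hSigma s (Finset.mem_range.1 hs)).2.1
      _ = ∑ t ∈ Finset.range x.n, x.colErr σ t (x.tau g t) := x.sum_rowErr _ _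
      _ ≤ ∑ t ∈ Finset.range x.n, x.colErr σ t (τ t) :=
          Finset.sum_le_sum fun t ht => (hTau t (Finset.mem_range.1 ht)).2.1
      _ = ∑ s ∈ Finset.range x.m, x.rowErr τ s (σ s) := (x.sum_rowErr _ _).symm
      _ ≤ x.k := h.2.2

theorem search_iff : x.Search ↔ ∃ σ τ, x.IsSol σ τ :=
  ⟨fun ⟨_, _, _, _, _, _, _, _, _, _, h⟩ => ⟨_, _, accept_isSol h⟩,
    fun ⟨_, _, h⟩ => search_of_isSol h⟩

theorem sum_rowErr_eq (σ : Fin x.m → Fin x.p) (τ : Fin x.n → Fin x.q) (σ' τ' : ℕ → ℕ)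
    (hσ : ∀ s : Fin x.m, σ' s = σ s) (hτ : ∀ t : Fin x.n, τ' t = τ t) :
    ((∑ s ∈ Finset.range x.m, x.rowErr τ' s (σ' s) : ℕ) : ℝ) =
      frobeniusSq x.A fun s t => x.P (σ s) (τ t) := by
  unfold frobeniusSq
  rw [Finset.sum_range, Nat.cast_sum]
  refine Finset.sum_congr rfl fun s _ => ?_
  rw [rowErr, numBelow_eq_sum, Finset.sum_range, Nat.cast_sum]
  refine Finset.sum_congr rfl fun t _ => ?_
  rw [toNat_sub_sq, ← rowMajor_apply, ← rowMajor_apply, hσ, hτ]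
  rfl

theorem isYes_iff : IsYes x.A x.P x.k ↔ ∃ σ τ, x.IsSol σ τ := by
  constructor
  · rintro ⟨B, ⟨I, J, hI, hJ, hB⟩, hk⟩
    choose σ hσ using hI.2.2
    choose τ hτ using hJ.2.2
    have huniq {m p : ℕ} {I : Fin p → Finset (Fin m)} (hI : IsPartition I) {σ : Fin m → Fin p}
        (hσ : ∀ s, s ∈ I (σ s)) : Onto m p fun s => if h : s < m then σ ⟨s, h⟩ else 0 := by
      refine ⟨fun s hs => by simp [hs], fun i hi => ?_⟩
      obtain ⟨s, hs⟩ := hI.1 ⟨i, hi⟩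
      refine ⟨s, s.2, ?_⟩
      by_contra hne
      refine Finset.disjoint_left.1 (hI.2.1 ⟨i, hi⟩ (σ s) fun h => hne ?_) hs (hσ s)
      simp [← h]
    refine ⟨_, _, huniq hI hσ, huniq hJ hτ, ?_⟩
    have h1 := sum_rowErr_eq (x := x) σ τ (fun s => if h : s < x.m then σ ⟨s, h⟩ else 0)
      (fun t => if h : t < x.n then τ ⟨t, h⟩ else 0) (by simp) (by simp)
    have h2 : B = fun s t => x.P (σ s) (τ t) := by
      ext s t
      exact hB _ _ s (hσ s) t (hτ t)
    rw [h2, ← h1] at hk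
    exact_mod_cast hk
  · rintro ⟨σ, τ, hσ, hτ, hk⟩
    have hpart {m p : ℕ} {σ : ℕ → ℕ} (h : Onto m p σ) : IsPartition fun i : Fin p =>
        (Finset.univ : Finset (Fin m)).filter fun s => σ s = i := by
      refine ⟨fun i => ?_, fun i i' hne => ?_, fun s => ⟨⟨σ s, h.1 s s.2⟩, by simp⟩⟩
      · obtain ⟨s, hs, he⟩ := h.2 i i.2
        exact ⟨⟨s, hs⟩, by simpa using he⟩
      · refine Finset.disjoint_left.2 fun s hs hs' => hne (Fin.ext ?_)
        simp only [Finset.mem_filter, Finset.mem_univ, true_and] at hs hs'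
        rw [← hs, ← hs']
    refine ⟨fun s t => x.P ⟨σ s, hσ.1 s s.2⟩ ⟨τ t, hτ.1 t t.2⟩,
      ⟨_, _, hpart hσ, hpart hτ, fun i j s hs t ht => ?_⟩, ?_⟩
    · simp only [Finset.mem_filter, Finset.mem_univ, true_and] at hs ht
      exact congrArg₂ x.P (Fin.ext hs) (Fin.ext ht)
    · rw [← sum_rowErr_eq (x := x) (fun s => ⟨σ s, hσ.1 s s.2⟩) (fun t => ⟨τ t, hτ.1 t t.2⟩) σ τ
        (fun _ => rfl) fun _ => rfl]
      exact_mod_cast hk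

theorem size_le (x : Inst) :
    (x.size : ℝ) ≤ 2 * (2 : ℝ) ^ exponent x.p x.q x.k * ((x.n : ℝ) * x.m) := by
  have h0 : 0 ≤ exponent x.p x.q x.k :=
    le_trans (by positivity) x.exponent_parts.2.1
  have h1 := (Nat.ceil_lt_add_one (a := (2 : ℝ) ^ exponent x.p x.q x.k) (by positivity)).le
  have h2 := Real.one_le_rpow (x := 2) (by norm_num) h0
  rw [size_eq, budget]
  push_cast
  exact mul_le_mul_of_nonneg_right (by linarith) (by positivity)

end Inst

end PMatrixApproximation

open PMatrixApproximation in
/-- One program decides all instances of the problem (answer in the variable `0`: `1` for yes, `0`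
for no), in at most `C · 2^(C · exponent p q k) · (nm)^C` steps for an absolute constant `C`. -/
theorem theorem8 :
    ∃ (prog : RAM.Prog) (C : ℕ),
      ∀ (m n p q k : ℕ), 1 ≤ m → 1 ≤ n → 1 ≤ p → 1 ≤ q →
      ∀ (A : Matrix (Fin m) (Fin n) Bool) (P : Matrix (Fin p) (Fin q) Bool),
        ∃ (final : RAM.Store) (steps : ℕ),
          RAM.Run prog (PMatrixApproximation.input A P k) final steps ∧
          (PMatrixApproximation.IsYes A P k → final.var 0 = 1) ∧
          (¬ PMatrixApproximation.IsYes A P k → final.var 0 = 0) ∧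
          (steps : ℝ) ≤ (C : ℝ) * (2 : ℝ) ^ ((C : ℝ) * PMatrixApproximation.exponent p q k)
            * ((n : ℝ) * (m : ℝ)) ^ C := by
  classical
  obtain ⟨-, t, ht, c, hc⟩ := PT.ite PD.search (.const 1) (.const 0)
  refine ⟨.seq (t.compile [] 5) (.assign 0 (.var 5)), 4 ^ c + c + 2, ?_⟩
  intro m n p q k hm hn hp hq A P
  set x : Inst := ⟨m, n, p, q, k, hm, hn, hp, hq, A, P⟩ with hx
  obtain ⟨s, T, hrun, -, hval, hT⟩ := t.run_compile x.store [] 5 x.store le_rfl (by simp)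
    ⟨rfl, fun _ _ => rfl⟩
  have hyes : IsYes A P k ↔ x.Search := (Inst.isYes_iff (x := x)).trans Inst.search_iff.symm
  have h1 := ht x
  have h2 := hc x
  change t.eval x.store [] = _ at h1
  change t.time x.store [] ≤ _ at h2
  rw [List.map_nil, h1] at hval
  refine ⟨_, _, .seq hrun (.assign _ _ _), fun h => ?_, fun h => ?_, ?_⟩
  · simp [RAM.Exp.eval, hval, hyes.1 h]
  · simp [RAM.Exp.eval, hval, mt hyes.2 h]
  · set E := exponent p q k with hE
    have hE0 : 0 ≤ E := le_trans (by positivity) x.exponent_parts.2.1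
    have h3 : 1 ≤ (2 : ℝ) ^ E := Real.one_le_rpow (by norm_num) hE0
    have h4 : (1 : ℝ) ≤ (n : ℝ) * m := by exact_mod_cast Nat.mul_pos hn hm
    have h5 : (csize x : ℝ) ≤ 4 * (2 : ℝ) ^ E * ((n : ℝ) * m) := by
      have h6 : (x.size : ℝ) ≤ 2 * (2 : ℝ) ^ E * ((n : ℝ) * m) := x.size_le
      have h7 : csize x = x.size + 0 + 2 := rfl
      rw [h7]
      push_cast
      nlinarith
    have h6 : (T : ℝ) ≤ 4 ^ c * ((2 : ℝ) ^ E) ^ c * ((n : ℝ) * m) ^ c := by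
      rw [← mul_pow, ← mul_pow]
      refine le_trans ?_ (pow_le_pow_left₀ (by positivity) h5 c)
      exact_mod_cast hT.trans h2
    set C := 4 ^ c + c + 2 with hC
    have hcC : c ≤ C := (Nat.le_add_left c _).trans (Nat.le_add_right _ 2)
    have h7 : ((2 : ℝ) ^ E) ^ c ≤ (2 : ℝ) ^ ((C : ℝ) * E) := by
      rw [mul_comm, Real.rpow_mul (by norm_num), Real.rpow_natCast]
      exact pow_le_pow_right₀ h3 hcC
    have h8 : ((n : ℝ) * m) ^ c ≤ ((n : ℝ) * m) ^ C := pow_le_pow_right₀ h4 hcC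
    have h9 : (1 : ℝ) ≤ (2 : ℝ) ^ ((C : ℝ) * E) * ((n : ℝ) * m) ^ C :=
      one_le_mul_of_one_le_of_one_le (Real.one_le_rpow (by norm_num) (by positivity))
        (one_le_pow₀ h4)
    have h10 : (T : ℝ) ≤ 4 ^ c * ((2 : ℝ) ^ ((C : ℝ) * E) * ((n : ℝ) * m) ^ C) := by
      rw [← mul_assoc]
      refine h6.trans ?_
      gcongr
    have h11 : (4 : ℝ) ^ c + 2 ≤ C := by
      rw [hC]
      push_cast
      linarith [Nat.cast_nonneg (α := ℝ) c]
    simp only [RAM.Exp.cost]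
    push_cast
    rw [mul_assoc]
    nlinarith
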